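/- **Setting.** Let $\mathbb T=\mathbb R/\mathbb Z$ with Lebesgue measure, let $c_0>0$, and let $\mathcal M(\mathbb T)$ be the space of finite signed Radon measures on $\mathbb T$ with the total variation norm; $\mathcal M^+(\mathbb T)$ is the set of positive ones. Let $U=L^2_{\mathrm{per},0}(\mathbb T)$ be the Hilbert space of the functions in $L^2(\mathbb T)$ with mean value zero (identified with its dual), and let $$\widetilde V=\{u\in W^{1,2}(\mathbb T):\ \textstyle\int_{\mathbb T}u\,dh=0,\ u_{hh}\in\mathcal M(\mathbb T)\},\qquad \|u\|_{\widetilde V}=\|u_{hh}\|_{\mathcal M(\mathbb T)},$$ derivatives being distributional. For $w\in\widetilde V$ write $w_{hh}=\eta+\nu$ with $\eta\in L^1(\mathbb T)$ the absolutely continuous part and $\nu$ the singular part with respect to Lebesgue measure. Define $\phi,\psi:\widetilde V\to[0,+\infty]$ by $$\phi(w)=\begin{cases}\int_{\mathbb T}\Phi(\eta+c_0)\,dh & \text{if } w_{hh}+c_0\in\mathcal M^+(\mathbb T),\\ +\infty&\text{otherwise,}\end{cases}\qquad \Phi(x)=\begin{cases}\tfrac12x^{-2}&x>0,\\+\infty&x\le0,\end{cases}$$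 and, for a constant $C>0$, $\psi(w)=0$ if $\|w\|_{\widetilde V}\le C$ and $\psi(w)=+\infty$ otherwise. Let $\widetilde B=\partial(\phi+\psi)$, where for $w\in\widetilde V$ $$\widetilde Bw=\{\xi\in\widetilde V':\ (\phi+\psi)(w)+\langle\xi,v-w\rangle\le(\phi+\psi)(v)\ \ \forall v\in\widetilde V\}.$$ Each $u\in U$ is regarded as the element $v\mapsto\langle u,v\rangle_U$ of $\widetilde V'$. Let $B$ be the restriction of $\widetilde B$ to $U$: $Bw=\widetilde Bw\cap U$ for $w\in\widetilde V$, and $Bw=\emptyset$ for $w\in U\setminus\widetilde V$, with $D(B)=\{w\in U:\ Bw\ne\emptyset\}$. For $T>0$, functions in $W^{1,\infty}([0,T];U)$ are identified with their continuous representatives. By $w\in L^\infty([0,T];\widetilde V)$ we mean that $w(t)\in\widetilde V$ for a.e. $t$, that $\|w(t)\|_{\widetilde V}$ is essentially bounded, and that $t\mapsto\int_{\mathbb T}f\,dw_{hh}(t)$ is measurable for every $f\in C(\mathbb T)$. A *variational inequality solution* of $w_t=[(w_{hh}+c_0)^{-3}]_{hh}$ on $[0,T]$ is a function $w\in L^\infty([0,T];\widetilde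 V)\cap C^0([0,T];U)$ with $w_t\in L^\infty([0,T];U)$ such that, for a.e. $t\in[0,T]$, $(\phi+\psi)(w(t))<+\infty$ and $$\langle w_t(t),v-w(t)\rangle_U+(\phi+\psi)(v)-(\phi+\psi)(w(t))\ge0\qquad\text{for all }v\in\widetilde V.$$ **Theorem.** Let $c_0>0$, $C>0$, $T>0$ and $w^0\in D(B)$. (i) There is a unique function $w\in W^{1,\infty}([0,T];U)$ such that $$-w_t(t)\in Bw(t)\quad\text{for a.e. }t\in[0,T],\qquad w(0)=w^0.$$ (ii) This $w$ is also a variational inequality solution of $w_t=[(w_{hh}+c_0)^{-3}]_{hh}$ on $[0,T]$. Moreover $w_{hh}(t)+c_0\in\mathcal M^+(\mathbb T)$ for a.e. $t\in[0,T]$, and the densities $\eta(t)$ of the absolutely continuous parts of $w_{hh}(t)$ have a jointly measurable version $\eta(t,h)$, which satisfies $\eta(t,h)+c_0>0$ for a.e. $(t,h)\in[0,T]\times\mathbb T$. -/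

import Mathlib

open MeasureTheory Set
open scoped ENNReal ContDiff

noncomputable section

namespace ThinFilm

/-- The torus `𝕋 = ℝ/ℤ`; its Lebesgue measure `volume` has total mass one. -/
abbrev Torus : Type := UnitAddCircle

/-! ### Calculus on the torus -/

/-- `f ∈ C^∞(𝕋)`: the associated `1`-periodic function on `ℝ` is smooth. -/
def SmoothOnTorus (f : Torus → ℝ) : Prop := ContDiff ℝ ∞ (fun s : ℝ => f (s : Torus))

/-- The classical derivative `f_h` of a function on the torus. -/
def dh (f : Torus → ℝ) (x : Torus) : ℝ := deriv (fun s : ℝ => f (x + (s : Torus))) 0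

/-- `L²(𝕋)`. -/
abbrev L2Torus : Type := Lp ℝ 2 (volume : Measure Torus)

/-- `U = L²_{per,0}(𝕋)`: the mean-zero functions of `L²(𝕋)`, with the `L²` inner product. -/
def USpace : Submodule ℝ L2Torus where
  carrier := {u | ∫ x, u x = 0}
  zero_mem' := by
    have h : ∫ x, (0 : L2Torus) x = ∫ _ : Torus, (0 : ℝ) :=
      integral_congr_ae (Lp.coeFn_zero ℝ 2 (volume : Measure Torus))
    exact h.trans (integral_zero _ _)
  add_mem' := by
    intro a b ha hb
    have hai := (Lp.memLp a).integrable (by norm_num)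
    have hbi := (Lp.memLp b).integrable (by norm_num)
    simp only [mem_ofPred_eq] at ha hb ⊢
    rw [integral_congr_ae (Lp.coeFn_add a b)]
    simp only [Pi.add_apply]
    rw [integral_add hai hbi, ha, hb, add_zero]
  smul_mem' := by
    intro c a ha
    simp only [mem_ofPred_eq] at ha ⊢
    rw [integral_congr_ae (Lp.coeFn_smul c a)]
    simp only [Pi.smul_apply]
    rw [integral_smul, ha, smul_zero]

/-- `U` is a Hilbert space. -/
instance : CompleteSpace USpace := by
  have h : IsClosed ((USpace : Submodule ℝ L2Torus) : Set L2Torus) := by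
    have he : ((USpace : Submodule ℝ L2Torus) : Set L2Torus) =
        {u | inner ℝ (indicatorConstLp 2 MeasurableSet.univ
          (measure_ne_top (volume : Measure Torus) univ) (1 : ℝ)) u = 0} := by
      ext u
      rw [mem_ofPred_eq, L2.inner_indicatorConstLp_one, Measure.restrict_univ]
      rfl
    rw [he]
    exact isClosed_eq (by fun_prop) continuous_const
  exact h.completeSpace_coe

/-- `u ∈ W^{1,2}(𝕋)`: the distributional derivative of `u` is an `L²` function. -/
def MemW12 (u : L2Torus) : Prop :=
  ∃ u' : L2Torus, ∀ f : Torus → ℝ, SmoothOnTorus f →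
    ∫ x, u x * dh f x = -∫ x, u' x * f x

/-- The second distributional derivative of `u` is the (finite, signed Radon) measure `μ`. -/
def IsSecondDeriv (u : L2Torus) (μ : SignedMeasure Torus) : Prop :=
  ∀ f : Torus → ℝ, SmoothOnTorus f →
    ∫ x, u x * dh (dh f) x = ∫ᵛ x, f x ∂<•μ

/-! ### Facts showing that `Ṽ` is a linear space -/

theorem SmoothOnTorus.continuous {f : Torus → ℝ} (hf : SmoothOnTorus f) : Continuous f :=
  (QuotientAddGroup.isQuotientMap_mk (N := AddSubgroup.zmultiples (1 : ℝ))).continuous_iff.2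
    (ContDiff.continuous hf)

theorem dh_coe (f : Torus → ℝ) (t : ℝ) :
    dh f (t : Torus) = deriv (fun s : ℝ => f (s : Torus)) t := by
  have h := deriv_comp_const_add (fun s : ℝ => f (s : Torus)) t 0
  simpa [dh, AddCircle.coe_add] using h

theorem SmoothOnTorus.dh {f : Torus → ℝ} (hf : SmoothOnTorus f) : SmoothOnTorus (dh f) := by
  unfold SmoothOnTorus
  simp only [dh_coe]
  exact (contDiff_infty_iff_deriv.1 hf).2

theorem SmoothOnTorus.memLp {f : Torus → ℝ} (hf : SmoothOnTorus f) :
    MemLp f 2 (volume : Measure Torus) :=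
  hf.continuous.memLp_of_hasCompactSupport (HasCompactSupport.of_compactSpace f)

theorem SmoothOnTorus.integrable_mul {f : Torus → ℝ} (hf : SmoothOnTorus f) (u : L2Torus) :
    Integrable (fun x => u x * f x) (volume : Measure Torus) :=
  (Lp.memLp u).integrable_mul hf.memLp

theorem SmoothOnTorus.integrable_signed {f : Torus → ℝ} (hf : SmoothOnTorus f)
    (μ : SignedMeasure Torus) : μ.Integrable f := by
  unfold VectorMeasure.Integrable
  rw [← SignedMeasure.totalVariation_eq_variation]
  exact hf.continuous.integrable_of_hasCompactSupport (HasCompactSupport.of_compactSpace f)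

theorem integral_lp_add_mul {g : Torus → ℝ} (hg : SmoothOnTorus g) (a b : L2Torus) :
    ∫ x, (a + b) x * g x = (∫ x, a x * g x) + ∫ x, b x * g x := by
  rw [← integral_add (hg.integrable_mul a) (hg.integrable_mul b)]
  refine integral_congr_ae ?_
  filter_upwards [Lp.coeFn_add a b] with x hx
  rw [hx, Pi.add_apply, add_mul]

theorem integral_lp_smul_mul (g : Torus → ℝ) (c : ℝ) (a : L2Torus) :
    ∫ x, (c • a) x * g x = c * ∫ x, a x * g x := by
  rw [← integral_const_mul]
  refine integral_congr_ae ?_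
  filter_upwards [Lp.coeFn_smul c a] with x hx
  rw [hx, Pi.smul_apply, smul_eq_mul, mul_assoc]

theorem MemW12.add {a b : L2Torus} (ha : MemW12 a) (hb : MemW12 b) : MemW12 (a + b) := by
  obtain ⟨a', ha⟩ := ha
  obtain ⟨b', hb⟩ := hb
  refine ⟨a' + b', fun f hf => ?_⟩
  rw [integral_lp_add_mul hf.dh, integral_lp_add_mul hf, ha f hf, hb f hf, neg_add]

theorem MemW12.smul {a : L2Torus} (c : ℝ) (ha : MemW12 a) : MemW12 (c • a) := by
  obtain ⟨a', ha⟩ := ha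
  refine ⟨c • a', fun f hf => ?_⟩
  rw [integral_lp_smul_mul, integral_lp_smul_mul, ha f hf, mul_neg]

theorem IsSecondDeriv.add {a b : L2Torus} {μ ν : SignedMeasure Torus}
    (ha : IsSecondDeriv a μ) (hb : IsSecondDeriv b ν) : IsSecondDeriv (a + b) (μ + ν) := by
  intro f hf
  rw [integral_lp_add_mul hf.dh.dh, ha f hf, hb f hf,
    VectorMeasure.integral_add_vectorMeasure (hf.integrable_signed μ) (hf.integrable_signed ν)]

theorem IsSecondDeriv.smul {a : L2Torus} {μ : SignedMeasure Torus} (c : ℝ)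
    (ha : IsSecondDeriv a μ) : IsSecondDeriv (c • a) (c • μ) := by
  intro f hf
  rw [integral_lp_smul_mul, ha f hf, VectorMeasure.integral_smul_vectorMeasure, smul_eq_mul]

/-! ### The space `Ṽ` -/

/-- `Ṽ = {u ∈ W^{1,2}_{per,0}(𝕋) : u_hh ∈ 𝓜(𝕋)}`, as a linear subspace of `U`. -/
def VTilde : Submodule ℝ USpace where
  carrier := {u | MemW12 (u : L2Torus) ∧ ∃ μ, IsSecondDeriv (u : L2Torus) μ}
  zero_mem' := by
    have h0 : ((0 : USpace) : L2Torus) = (0 : ℝ) • (0 : L2Torus) := by simp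
    constructor
    · refine ⟨0, fun f _ => ?_⟩
      rw [h0, integral_lp_smul_mul, zero_mul, ← zero_smul ℝ (0 : L2Torus),
        integral_lp_smul_mul, zero_mul, neg_zero]
    · refine ⟨0, fun f _ => ?_⟩
      rw [h0, integral_lp_smul_mul, zero_mul, VectorMeasure.integral_zero_vectorMeasure]
  add_mem' := by
    rintro a b ⟨ha, μ, hμ⟩ ⟨hb, ν, hν⟩
    exact ⟨ha.add hb, μ + ν, hμ.add hν⟩
  smul_mem' := by
    rintro c a ⟨ha, μ, hμ⟩
    exact ⟨ha.smul c, c • μ, hμ.smul c⟩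

open Classical in
/-- The measure `u_hh`, the (unique) second distributional derivative of `u`, for `u ∈ Ṽ`
(and `0` if the second distributional derivative of `u ∈ U` is not a measure). -/
def hh (u : USpace) : SignedMeasure Torus :=
  if h : ∃ μ, IsSecondDeriv (u : L2Torus) μ then h.choose else 0

theorem hh_spec {u : USpace} (hu : u ∈ VTilde) : IsSecondDeriv (u : L2Torus) (hh u) := by
  have h : ∃ μ, IsSecondDeriv (u : L2Torus) μ := hu.2
  rw [hh, dif_pos h]
  exact h.choose_spec

/-- `‖w‖_Ṽ = ‖w_hh‖_{𝓜(𝕋)}`, the total variation of `w_hh`. -/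
def normV (w : USpace) : ℝ := (hh w).totalVariation.real univ

/-- The Lebesgue density `η ∈ L¹(𝕋)` of the absolutely continuous part of `w_hh`. -/
def acDensity (w : USpace) : Torus → ℝ := (hh w).rnDeriv volume

/-- `w_hh + c₀` is a positive measure. -/
def PosMeasure (c₀ : ℝ) (w : USpace) : Prop :=
  0 ≤ hh w + c₀ • (volume : Measure Torus).toSignedMeasure

/-! ### The functionals `φ` and `ψ` -/

/-- `Φ(x) = x⁻²/2` for `x > 0` and `Φ(x) = +∞` for `x ≤ 0`. -/
def Phi (x : ℝ) : ℝ≥0∞ := if x ≤ 0 then ⊤ else ENNReal.ofReal ((x ^ 2)⁻¹ / 2)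

open Classical in
/-- `φ(w) = ∫ Φ(η + c₀)` if `w_hh + c₀` is a positive measure, and `+∞` otherwise. -/
def phi (c₀ : ℝ) (w : VTilde) : ℝ≥0∞ :=
  if PosMeasure c₀ w then ∫⁻ x, Phi (acDensity w x + c₀) else ⊤

open Classical in
/-- The indicator functional of the ball of radius `C` in `Ṽ`. -/
def psi (C : ℝ) (w : VTilde) : ℝ≥0∞ := if normV w ≤ C then 0 else ⊤

/-- `φ + ψ : Ṽ → ℝ ∪ {+∞}`. -/
def energy (c₀ C : ℝ) (w : VTilde) : EReal := ((phi c₀ w + psi C w : ℝ≥0∞) : EReal)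

/-! ### Subdifferentials and the operator `B` -/

/-- The subdifferential at `x` of a functional `f` on a real vector space `X` with norm `N`:
the set of the `N`-bounded linear functionals `ξ` such that `f x + ⟨ξ, y - x⟩ ≤ f y` for
every `y`. -/
def subdifferential {X : Type*} [AddCommGroup X] [Module ℝ X] (N : X → ℝ) (f : X → EReal)
    (x : X) : Set (X →ₗ[ℝ] ℝ) :=
  {ξ | (∃ K : ℝ, ∀ v, |ξ v| ≤ K * N v) ∧ ∀ y, f x + (ξ (y - x) : EReal) ≤ f y}

/-- `B̃ = ∂(φ + ψ) : Ṽ → Ṽ'`. -/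
def BTilde (c₀ C : ℝ) (w : VTilde) : Set (VTilde →ₗ[ℝ] ℝ) :=
  subdifferential (fun v : VTilde => normV v) (energy c₀ C) w

/-- The inclusion of `U` (identified with `U'`) in `Ṽ'`: `u` acts on `Ṽ` as `v ↦ ⟨u, v⟩_U`. -/
def toDual (u : USpace) : VTilde →ₗ[ℝ] ℝ :=
  (innerSL ℝ u : USpace →ₗ[ℝ] ℝ) ∘ₗ VTilde.subtype

/-- The multivalued operator `B` on `U`, the restriction of `B̃` to `U`: `u ∈ B w` if and only if
`w ∈ Ṽ` and `u`, as a functional on `Ṽ`, belongs to `B̃ w`. -/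
def B (c₀ C : ℝ) (w : USpace) : Set USpace :=
  {u | ∃ hw : w ∈ VTilde, toDual u ∈ BTilde c₀ C ⟨w, hw⟩}

/-- `D(B)`. -/
def domB (c₀ C : ℝ) : Set USpace := {w | (B c₀ C w).Nonempty}

/-! ### Functions of time -/

/-- `w ∈ W^{1,∞}([0,T];U)` with weak time derivative `w_t = w'`; `w` is the continuous
representative. -/
structure MemW1Inf (T : ℝ) (w w' : ℝ → USpace) : Prop where
  continuousOn : ContinuousOn w (Icc 0 T)
  memLp : MemLp w ⊤ (volume.restrict (Icc 0 T))
  memLp_deriv : MemLp w' ⊤ (volume.restrict (Icc 0 T))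
  weak_deriv : ∀ θ : ℝ → ℝ, ContDiff ℝ ∞ θ → HasCompactSupport θ → tsupport θ ⊆ Ioo 0 T →
    ∫ t in Icc 0 T, deriv θ t • w t = -∫ t in Icc 0 T, θ t • w' t

/-- `w ∈ L^∞([0,T];Ṽ)`: `w(t)` lies in a fixed ball of `Ṽ` for a.e. `t`, and `t ↦ w_hh(t)` is
weakly-* measurable. -/
structure MemLInfV (T : ℝ) (w : ℝ → USpace) : Prop where
  mem : ∀ᵐ t ∂(volume.restrict (Icc 0 T)), w t ∈ VTilde
  bounded : ∃ K : ℝ, ∀ᵐ t ∂(volume.restrict (Icc 0 T)), normV (w t) ≤ K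
  measurable : ∀ f : C(Torus, ℝ),
    AEMeasurable (fun t => ∫ᵛ x, f x ∂<•(hh (w t))) (volume.restrict (Icc 0 T))

/-- `w` is a strong solution, on `[0,T]`, of the Cauchy problem `-w_t ∈ B w`, `w(0) = w⁰`, in
`W^{1,∞}([0,T];U)`, with `w_t = w'`. -/
structure IsCauchySolution (c₀ C T : ℝ) (w₀ : USpace) (w w' : ℝ → USpace) : Prop where
  memW1Inf : MemW1Inf T w w'
  inclusion : ∀ᵐ t ∂(volume.restrict (Icc 0 T)), -w' t ∈ B c₀ C (w t)
  initial : w 0 = w₀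

/-- `w`, with `w_t = w'`, is a variational inequality solution on `[0,T]` of
`w_t = [(w_hh + c₀)⁻³]_hh`: `w ∈ L^∞([0,T];Ṽ) ∩ C⁰([0,T];U)`, `w_t ∈ L^∞([0,T];U)`, and
`⟨w_t, v - w⟩ + (φ+ψ)(v) - (φ+ψ)(w) ≥ 0` for a.e. `t` and all `v ∈ Ṽ`. -/
structure IsVISolution (c₀ C T : ℝ) (w w' : ℝ → USpace) : Prop where
  memW1Inf : MemW1Inf T w w'
  memLInfV : MemLInfV T w
  ineq : ∀ᵐ t ∂(volume.restrict (Icc 0 T)), ∃ hw : w t ∈ VTilde, ∀ v : VTilde,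
    energy c₀ C ⟨w t, hw⟩ ≤ ((inner ℝ (w' t) ((v : USpace) - w t) : ℝ) : EReal) + energy c₀ C v

/-- The two positivity properties, on `[0,T]`: `w_hh(t) + c₀` is a positive measure for a.e. `t`,
and `η + c₀ > 0` for a.e. `(t,h)`, where `η` is a (jointly measurable) function on `[0,T] × 𝕋`
whose slice `η(t,·)` is the density of the absolutely continuous part of `w_hh(t)` for a.e. `t`. -/
structure IsPositive (c₀ T : ℝ) (w : ℝ → USpace) : Prop where
  mem : ∀ᵐ t ∂(volume.restrict (Icc 0 T)), w t ∈ VTilde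
  measure : ∀ᵐ t ∂(volume.restrict (Icc 0 T)), PosMeasure c₀ (w t)
  density : ∃ η : ℝ → Torus → ℝ,
    AEStronglyMeasurable (Function.uncurry η)
      ((volume.restrict (Icc 0 T)).prod (volume : Measure Torus)) ∧
    (∀ᵐ t ∂(volume.restrict (Icc 0 T)), η t =ᵐ[(volume : Measure Torus)] acDensity (w t)) ∧
    ∀ᵐ p ∂((volume.restrict (Icc 0 T)).prod (volume : Measure Torus)), 0 < η p.1 p.2 + c₀

end ThinFilm

end

/-!
For `u ∈ U` with `u_hh + c₀ ≥ 0`, the measure `μ = u_hh + c₀` has mass `c₀`. Young's inequality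
`Φ(x) ≥ 3 b² / 2 - b³ x` for `b ≥ 0`, with equality for `b = 1 / x`, makes `φ(u)` a supremum of
functions of `μ` that are affine and continuous for the weak-* topology; the singular part of `μ`
is invisible to this supremum. As the total variation is such a supremum too, and the positive
measures of mass `c₀` are weakly-* compact, `φ + ψ` is convex and lower semicontinuous on the
Hilbert space `U`, and `B` is its subdifferential there.

The solution is the gradient flow of `φ + ψ`. Implicit Euler schemes with dyadic time steps, each
compared with its refinement, converge to a Lipschitz curve satisfying an integrated evolution
variational inequality. This curve is differentiable almost everywhere (Rademacher), and
differentiating the inequality yields `-w_t ∈ B w`. Uniqueness is the monotonicity of `B`. Finally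
`φ(w(t)) < ∞` forces `η(t) + c₀ > 0` almost everywhere.
-/

namespace ConvexFlow

open Filter Topology
open scoped RealInnerProductSpace

variable {H : Type*} [NormedAddCommGroup H] [InnerProductSpace ℝ H]
  {D : Set H} {e : H → ℝ} {τ : ℝ}

/-- `ξ` is a subgradient at `x` of the functional on `H` equal to `e` on `D` and to `+∞` off `D`.
Functionals with values in `ℝ ∪ {+∞}` are encoded by such pairs `(D, e)` throughout, so that lower
semicontinuity reads `∀ K, IsClosed {x | x ∈ D ∧ e x ≤ K}`. -/
def IsSubgradient (D : Set H) (e : H → ℝ) (x ξ : H) : Prop :=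
  x ∈ D ∧ ∀ y ∈ D, e x + ⟪ξ, y - x⟫ ≤ e y

theorem IsSubgradient.inner_sub_sub_nonneg {x y ξ ζ : H}
    (hx : IsSubgradient D e x ξ) (hy : IsSubgradient D e y ζ) : 0 ≤ ⟪ξ - ζ, x - y⟫ := by
  have hxy := hx.2 y hy.1
  have hyx := hy.2 x hx.1
  rw [← neg_sub x y, inner_neg_right] at hxy
  rw [inner_sub_left]
  linarith

theorem mem_and_le_of_tendsto {X : Type*} [TopologicalSpace X] {D : Set X} {e : X → ℝ}
    (hcl : ∀ K, IsClosed {x | x ∈ D ∧ e x ≤ K}) {u : ℕ → X} {x : X} {k : ℕ → ℝ} {K : ℝ}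
    (hu : Tendsto u atTop (𝓝 x)) (hD : ∀ n, u n ∈ D) (hk : ∀ᶠ n in atTop, e (u n) ≤ k n)
    (hK : Tendsto k atTop (𝓝 K)) : x ∈ D ∧ e x ≤ K := by
  have mem_sublevel (ε : ℝ) (hε : 0 < ε) : x ∈ D ∧ e x ≤ K + ε := by
    refine (hcl (K + ε)).mem_of_tendsto hu ?_
    filter_upwards [hk, hK.eventually_le_const (lt_add_of_pos_right K hε)] with n hn hKn
    exact ⟨hD n, hn.trans hKn⟩
  exact ⟨(mem_sublevel 1 one_pos).1, le_of_forall_pos_le_add fun ε hε => (mem_sublevel ε hε).2⟩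

section Resolvent

/-- The objective `e(x) + ‖x - f‖² / (2τ)` of the proximal step of size `τ` from `f`, whose
minimizers solve `x + τ ∂e(x) ∋ f`. -/
noncomputable def proxObjective (e : H → ℝ) (τ : ℝ) (f x : H) : ℝ := e x + (2 * τ)⁻¹ * ‖x - f‖ ^ 2

theorem IsSubgradient.bddBelow_proxObjective {x₀ ξ₀ : H} (h₀ : IsSubgradient D e x₀ ξ₀)
    (hτ : 0 < τ) (f : H) : BddBelow (proxObjective e τ f '' D) := by
  refine ⟨e x₀ + ⟪ξ₀, f - x₀⟫ - τ / 2 * ‖ξ₀‖ ^ 2, ?_⟩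
  rintro _ ⟨x, hx, rfl⟩
  have hsub := h₀.2 x hx
  rw [← sub_add_sub_cancel x f x₀, inner_add_right] at hsub
  have hsq : (2 * τ)⁻¹ * ‖x - f + τ • ξ₀‖ ^ 2 =
      (2 * τ)⁻¹ * ‖x - f‖ ^ 2 + ⟪ξ₀, x - f⟫ + τ / 2 * ‖ξ₀‖ ^ 2 := by
    rw [norm_add_sq_real, inner_smul_right, norm_smul, Real.norm_of_nonneg hτ.le, real_inner_comm]
    field_simp
  have hsq_nonneg : 0 ≤ (2 * τ)⁻¹ * ‖x - f + τ • ξ₀‖ ^ 2 := by positivity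
  simp only [proxObjective]
  linarith

/-- The strong convexity of the proximal objective makes minimizing sequences Cauchy. -/
theorem norm_sub_sq_le_of_le_proxObjective (hconv : ConvexOn ℝ D e) (hτ : 0 < τ) {f : H} {m : ℝ}
    (hm : ∀ x ∈ D, m ≤ proxObjective e τ f x) {a b : H} (ha : a ∈ D) (hb : b ∈ D) :
    ‖a - b‖ ^ 2 ≤ 4 * τ * (proxObjective e τ f a + proxObjective e τ f b - 2 * m) := by
  have hmid := hm _ (hconv.1 ha hb one_half_pos.le one_half_pos.le (add_halves 1))
  have hconv_mid := hconv.2 ha hb one_half_pos.le one_half_pos.le (add_halves 1)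
  have hcentre : (1 / 2 : ℝ) • a + (1 / 2 : ℝ) • b - f = (1 / 2 : ℝ) • ((a - f) + (b - f)) := by
    module
  have hpar := parallelogram_law_with_norm ℝ (a - f) (b - f)
  rw [sub_sub_sub_cancel_right] at hpar
  have hnorm : ‖(1 / 2 : ℝ) • a + (1 / 2 : ℝ) • b - f‖ ^ 2 =
      (‖a - f‖ ^ 2 + ‖b - f‖ ^ 2) / 2 - ‖a - b‖ ^ 2 / 4 := by
    rw [hcentre, norm_smul, mul_pow, Real.norm_of_nonneg one_half_pos.le]
    linarith
  simp only [proxObjective, smul_eq_mul] at hmid hconv_mid ⊢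
  rw [hnorm] at hmid
  have hscaled : (2 * τ)⁻¹ * ‖a - b‖ ^ 2 ≤
      2 * (e a + (2 * τ)⁻¹ * ‖a - f‖ ^ 2 + (e b + (2 * τ)⁻¹ * ‖b - f‖ ^ 2) - 2 * m) := by
    nlinarith
  rw [inv_mul_le_iff₀ (by positivity)] at hscaled
  linarith

theorem exists_isMinOn_proxObjective [CompleteSpace H] (hconv : ConvexOn ℝ D e)
    (hcl : ∀ K, IsClosed {x | x ∈ D ∧ e x ≤ K}) (hne : D.Nonempty) (hτ : 0 < τ) {f : H}
    (hbdd : BddBelow (proxObjective e τ f '' D)) : ∃ x ∈ D, IsMinOn (proxObjective e τ f) D x := by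
  set m := sInf (proxObjective e τ f '' D)
  have hm : ∀ x ∈ D, m ≤ proxObjective e τ f x := fun x hx => csInf_le hbdd ⟨x, hx, rfl⟩
  have hmin (n : ℕ) : ∃ x ∈ D, proxObjective e τ f x ≤ m + 1 / ((n : ℝ) + 1) := by
    obtain ⟨_, ⟨x, hx, rfl⟩, h⟩ := exists_lt_of_csInf_lt (hne.image _)
      (lt_add_of_pos_right m (Nat.one_div_pos_of_nat (n := n)))
    exact ⟨x, hx, h.le⟩
  choose x hxD hxm using hmin
  have hcauchy : CauchySeq x := by
    refine cauchySeq_of_le_tendsto_0' (fun n : ℕ => √(8 * τ * (1 / ((n : ℝ) + 1))))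
      (fun n k hnk => ?_) ?_
    · rw [dist_eq_norm]
      refine Real.le_sqrt_of_sq_le ?_
      refine (norm_sub_sq_le_of_le_proxObjective hconv hτ hm (hxD n) (hxD k)).trans ?_
      have hkn : 1 / ((k : ℝ) + 1) ≤ 1 / ((n : ℝ) + 1) := Nat.one_div_le_one_div hnk
      nlinarith [hxm n, hxm k]
    · simpa using ((tendsto_one_div_add_atTop_nhds_zero_nat (𝕜 := ℝ)).const_mul (8 * τ)).sqrt
  obtain ⟨z, hz⟩ := cauchySeq_tendsto_of_complete hcauchy
  have hlim : Tendsto (fun n : ℕ => m + 1 / ((n : ℝ) + 1) - (2 * τ)⁻¹ * ‖x n - f‖ ^ 2) atTop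
      (𝓝 (m + 0 - (2 * τ)⁻¹ * ‖z - f‖ ^ 2)) :=
    (tendsto_const_nhds.add tendsto_one_div_add_atTop_nhds_zero_nat).sub
      (((hz.sub_const f).norm.pow 2).const_mul _)
  obtain ⟨hzD, hze⟩ := mem_and_le_of_tendsto hcl hz hxD
    (Eventually.of_forall fun n => le_sub_iff_add_le.2 (hxm n)) hlim
  refine ⟨z, hzD, fun y hy => le_trans ?_ (hm y hy)⟩
  rw [add_zero, le_sub_iff_add_le] at hze
  exact hze

theorem isSubgradient_of_isMinOn_proxObjective (hconv : ConvexOn ℝ D e) (hτ : 0 < τ) {f z : H}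
    (hzD : z ∈ D) (hz : IsMinOn (proxObjective e τ f) D z) :
    IsSubgradient D e z (τ⁻¹ • (f - z)) := by
  refine ⟨hzD, fun y hy => ?_⟩
  have hsegment : ∀ s ∈ Ioo (0 : ℝ) 1,
      e z + ⟪τ⁻¹ • (f - z), y - z⟫ ≤ e y + s * ((2 * τ)⁻¹ * ‖y - z‖ ^ 2) := by
    intro s ⟨hs0, hs1⟩
    have hmin := isMinOn_iff.1 hz _ (hconv.1 hzD hy (sub_nonneg.2 hs1.le) hs0.le (by ring))
    have hconv_s := hconv.2 hzD hy (sub_nonneg.2 hs1.le) hs0.le (by ring)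
    have hpoint : (1 - s) • z + s • y - f = (z - f) + s • (y - z) := by module
    have hinner : ⟪τ⁻¹ • (f - z), y - z⟫ = -(2 * τ)⁻¹ * (2 * ⟪z - f, y - z⟫) := by
      rw [real_inner_smul_left, ← neg_sub z f, inner_neg_left]
      field_simp
    simp only [proxObjective, smul_eq_mul] at hmin hconv_s
    rw [hpoint, norm_add_sq_real, norm_smul, mul_pow, inner_smul_right, Real.norm_eq_abs,
      sq_abs] at hmin
    rw [hinner]
    refine le_of_mul_le_mul_left ?_ hs0
    nlinarith
  have hlim : Tendsto (fun s : ℝ => e y + s * ((2 * τ)⁻¹ * ‖y - z‖ ^ 2)) (𝓝[>] 0) (𝓝 (e y)) := by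
    refine (Continuous.tendsto' (by fun_prop) 0 _ ?_).mono_left nhdsWithin_le_nhds
    rw [zero_mul, add_zero]
  refine ge_of_tendsto hlim ?_
  filter_upwards [Ioo_mem_nhdsGT (zero_lt_one (α := ℝ))] with s hs using hsegment s hs

theorem IsSubgradient.exists_resolvent [CompleteSpace H] {x₀ ξ₀ : H}
    (h₀ : IsSubgradient D e x₀ ξ₀) (hconv : ConvexOn ℝ D e)
    (hcl : ∀ K, IsClosed {x | x ∈ D ∧ e x ≤ K}) (hτ : 0 < τ) (f : H) :
    ∃ x, IsSubgradient D e x (τ⁻¹ • (f - x)) := by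
  obtain ⟨x, hx, hmin⟩ :=
    exists_isMinOn_proxObjective hconv hcl ⟨x₀, h₀.1⟩ hτ (h₀.bddBelow_proxObjective hτ f)
  exact ⟨x, isSubgradient_of_isMinOn_proxObjective hconv hτ hx hmin⟩

end Resolvent

section ImplicitEuler

/-- `u` solves the implicit Euler scheme `(u (k + 1) - u k) / τ ∈ -∂e (u (k + 1))` with step `τ`.
The subgradients `ξ k ∈ ∂e (u k)` include one at the initial point `u 0`. -/
structure IsEuler (D : Set H) (e : H → ℝ) (τ : ℝ) (u ξ : ℕ → H) : Prop where
  subgrad : ∀ k, IsSubgradient D e (u k) (ξ k)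
  step : ∀ k, u (k + 1) = u k - τ • ξ (k + 1)

theorem IsSubgradient.exists_isEuler [CompleteSpace H] {x₀ ξ₀ : H}
    (h₀ : IsSubgradient D e x₀ ξ₀) (hconv : ConvexOn ℝ D e)
    (hcl : ∀ K, IsClosed {x | x ∈ D ∧ e x ≤ K}) (hτ : 0 < τ) :
    ∃ u ξ : ℕ → H, IsEuler D e τ u ξ ∧ u 0 = x₀ ∧ ξ 0 = ξ₀ := by
  choose J hJ using h₀.exists_resolvent hconv hcl hτ
  let u : ℕ → H := fun n => J^[n] x₀
  let ξ : ℕ → H := fun n => Nat.casesOn n ξ₀ fun k => τ⁻¹ • (u k - J (u k))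
  have hu (k : ℕ) : u (k + 1) = J (u k) := Function.iterate_succ_apply' J k x₀
  refine ⟨u, ξ, ⟨fun k => ?_, fun k => ?_⟩, rfl, rfl⟩
  · cases k with
    | zero => exact h₀
    | succ k => exact hu k ▸ hJ (u k)
  · rw [hu, smul_inv_smul₀ hτ.ne', sub_sub_cancel]

namespace IsEuler

variable {u ξ y ζ : ℕ → H}

theorem norm_subgrad_antitone (h : IsEuler D e τ u ξ) (hτ : 0 < τ) : Antitone fun k => ‖ξ k‖ := by
  refine antitone_nat_of_succ_le fun k => ?_
  have hmono := (h.subgrad (k + 1)).inner_sub_sub_nonneg (h.subgrad k)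
  rw [h.step k, sub_sub_cancel_left, inner_neg_right, inner_smul_right, inner_sub_left,
    real_inner_self_eq_norm_sq, ← mul_neg, mul_nonneg_iff_of_pos_left hτ, neg_sub,
    sub_nonneg, sq] at hmono
  have hcs := hmono.trans (real_inner_le_norm (ξ k) (ξ (k + 1)))
  rcases (norm_nonneg (ξ (k + 1))).eq_or_lt with hzero | hpos
  · exact hzero ▸ norm_nonneg (ξ k)
  · exact le_of_mul_le_mul_right hcs hpos

theorem norm_subgrad_le (h : IsEuler D e τ u ξ) (hτ : 0 < τ) (k : ℕ) : ‖ξ k‖ ≤ ‖ξ 0‖ :=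
  h.norm_subgrad_antitone hτ k.zero_le

theorem norm_succ_sub_le (h : IsEuler D e τ u ξ) (hτ : 0 < τ) (k : ℕ) :
    ‖u (k + 1) - u k‖ ≤ τ * ‖ξ 0‖ := by
  rw [h.step k, sub_sub_cancel_left, norm_neg, norm_smul, Real.norm_of_nonneg hτ.le]
  exact mul_le_mul_of_nonneg_left (h.norm_subgrad_le hτ _) hτ.le

theorem norm_add_sub_le (h : IsEuler D e τ u ξ) (hτ : 0 < τ) (j i : ℕ) :
    ‖u (j + i) - u j‖ ≤ i * (τ * ‖ξ 0‖) := by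
  induction i with
  | zero => simp
  | succ i ih =>
    have htri := norm_sub_le_norm_sub_add_norm_sub (u (j + i + 1)) (u (j + i)) (u j)
    have hstep := h.norm_succ_sub_le hτ (j + i)
    rw [← add_assoc]
    push_cast
    linarith

theorem energy_antitone (h : IsEuler D e τ u ξ) (hτ : 0 < τ) : Antitone fun k => e (u k) := by
  refine antitone_nat_of_succ_le fun k => ?_
  have hsub := (h.subgrad (k + 1)).2 (u k) (h.subgrad k).1
  rw [h.step k, sub_sub_cancel, inner_smul_right, real_inner_self_eq_norm_sq, ← h.step k] at hsub
  have : 0 ≤ τ * ‖ξ (k + 1)‖ ^ 2 := by positivity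
  linarith

theorem evi_succ (h : IsEuler D e τ u ξ) (hτ : 0 < τ) {v : H} (hv : v ∈ D) (k : ℕ) :
    ‖u (k + 1) - v‖ ^ 2 / 2 - ‖u k - v‖ ^ 2 / 2 ≤ τ * (e v - e (u (k + 1))) := by
  have hsub := (h.subgrad (k + 1)).2 v hv
  rw [← neg_sub (u (k + 1)) v, inner_neg_right] at hsub
  have hprev : u k - v = (u (k + 1) - v) + τ • ξ (k + 1) := by rw [h.step k]; abel
  have hexpand : ‖u k - v‖ ^ 2 = ‖u (k + 1) - v‖ ^ 2
      + 2 * (τ * ⟪ξ (k + 1), u (k + 1) - v⟫) + ‖τ • ξ (k + 1)‖ ^ 2 := by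
    rw [hprev, norm_add_sq_real, inner_smul_right, real_inner_comm]
  nlinarith [sq_nonneg ‖τ • ξ (k + 1)‖]

theorem evi (h : IsEuler D e τ u ξ) (hτ : 0 < τ) {v : H} (hv : v ∈ D) (j i : ℕ) :
    ‖u (j + i) - v‖ ^ 2 / 2 - ‖u j - v‖ ^ 2 / 2 ≤ i * τ * (e v - e (u (j + i))) := by
  induction i with
  | zero => simp
  | succ i ih =>
    have hstep := h.evi_succ hτ hv (j + i)
    have henergy : e (u (j + i + 1)) ≤ e (u (j + i)) := h.energy_antitone hτ (j + i).le_succ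
    have hprev : i * τ * (e v - e (u (j + i))) ≤ i * τ * (e v - e (u (j + i + 1))) := by gcongr
    rw [← add_assoc]
    push_cast
    linarith

/-- One step of size `τ` is compared with two steps of size `τ / 2`: the cross terms are
nonnegative by monotonicity, up to an error of order `τ²`. -/
theorem norm_sub_half_succ_le (h : IsEuler D e τ u ξ) (hτ : 0 < τ)
    (hy : IsEuler D e (τ / 2) y ζ) {M : ℝ} (hξ : ‖ξ 0‖ ≤ M) (hζ : ‖ζ 0‖ ≤ M) (k l : ℕ) :
    ‖u (k + 1) - y (l + 1 + 1)‖ ^ 2 ≤ ‖u k - y l‖ ^ 2 + (τ * M) ^ 2 := by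
  have hM : 0 ≤ M := (norm_nonneg _).trans hξ
  set d := u (k + 1) - y (l + 1 + 1) with hd
  set a := ξ (k + 1)
  set b := ζ (l + 1)
  set c := ζ (l + 1 + 1)
  have hprev : u k - y l = d + (τ / 2) • ((a - b) + (a - c)) := by
    rw [hd, h.step k, hy.step (l + 1), hy.step l]
    module
  have hmid : d = (u (k + 1) - y (l + 1)) + (τ / 2) • c := by rw [hd, hy.step (l + 1)]; module
  have hac : 0 ≤ ⟪a - c, d⟫ := (h.subgrad _).inner_sub_sub_nonneg (hy.subgrad _)
  have hbound : -(2 * M * M) ≤ ⟪a - b, c⟫ := by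
    have ha : ‖a‖ ≤ M := (h.norm_subgrad_le hτ _).trans hξ
    have hb : ‖b‖ ≤ M := (hy.norm_subgrad_le (half_pos hτ) _).trans hζ
    have hc : ‖c‖ ≤ M := (hy.norm_subgrad_le (half_pos hτ) _).trans hζ
    have hprod : ‖a - b‖ * ‖c‖ ≤ (2 * M) * M :=
      mul_le_mul ((norm_sub_le _ _).trans (by linarith)) hc (norm_nonneg _) (by positivity)
    exact neg_le_of_abs_le ((abs_real_inner_le_norm (a - b) c).trans hprod)
  have hab : -(τ * M ^ 2) ≤ ⟪a - b, d⟫ := by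
    have hmono : 0 ≤ ⟪a - b, u (k + 1) - y (l + 1)⟫ :=
      (h.subgrad _).inner_sub_sub_nonneg (hy.subgrad _)
    rw [hmid, inner_add_right, inner_smul_right]
    nlinarith
  have hexpand : ‖u k - y l‖ ^ 2 = ‖d‖ ^ 2 + τ * (⟪a - b, d⟫ + ⟪a - c, d⟫)
      + ‖(τ / 2) • ((a - b) + (a - c))‖ ^ 2 := by
    rw [hprev, norm_add_sq_real, inner_smul_right, inner_add_right, real_inner_comm (a - b),
      real_inner_comm (a - c)]
    ring
  have hcross : τ * -(τ * M ^ 2) ≤ τ * (⟪a - b, d⟫ + ⟪a - c, d⟫) :=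
    mul_le_mul_of_nonneg_left (by linarith) hτ.le
  nlinarith [sq_nonneg ‖(τ / 2) • ((a - b) + (a - c))‖]

theorem norm_sub_half_le (h : IsEuler D e τ u ξ) (hτ : 0 < τ) (hy : IsEuler D e (τ / 2) y ζ)
    (h0 : u 0 = y 0) {M : ℝ} (hξ : ‖ξ 0‖ ≤ M) (hζ : ‖ζ 0‖ ≤ M) (k : ℕ) :
    ‖u k - y (2 * k)‖ ^ 2 ≤ k * (τ * M) ^ 2 := by
  induction k with
  | zero => simp [h0]
  | succ k ih =>
    have hstep := h.norm_sub_half_succ_le hτ hy hξ hζ k (2 * k)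
    rw [mul_add_one 2 k]
    push_cast
    linarith

end IsEuler

end ImplicitEuler

section Limit

/-- The piecewise constant interpolation in time, with step `τ`, of the sequence `u`. -/
noncomputable def interp (τ : ℝ) (u : ℕ → H) (t : ℝ) : H := u ⌊t / τ⌋₊

/-- `w` satisfies on `[0, ∞)`, in integrated form, the evolution variational inequality
`d/dt ‖w - v‖² / 2 ≤ e v - e w` for all `v ∈ D`, which characterizes the gradient flow of `e`. -/
structure IsEVISolution (D : Set H) (e : H → ℝ) (w : ℝ → H) : Prop where
  mem : ∀ t, 0 ≤ t → w t ∈ D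
  evi : ∀ v ∈ D, ∀ s t, 0 ≤ s → s < t →
    ‖w t - v‖ ^ 2 / 2 - ‖w s - v‖ ^ 2 / 2 ≤ (t - s) * (e v - e (w t))

theorem floor_mul_two_eq_or (x : ℝ) (hx : 0 ≤ x) :
    ⌊x * 2⌋₊ = 2 * ⌊x⌋₊ ∨ ⌊x * 2⌋₊ = 2 * ⌊x⌋₊ + 1 := by
  have hle := Nat.floor_le hx
  have hlt := Nat.lt_floor_add_one x
  have hlower : 2 * ⌊x⌋₊ ≤ ⌊x * 2⌋₊ := Nat.le_floor (by push_cast; linarith)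
  have hupper : ⌊x * 2⌋₊ < 2 * ⌊x⌋₊ + 2 := by
    rw [Nat.floor_lt (by positivity)]
    push_cast
    linarith
  lia

theorem tendsto_floor_div_mul {τ : ℕ → ℝ} (hτ : ∀ n, 0 < τ n) (hτ0 : Tendsto τ atTop (𝓝 0))
    {t : ℝ} (ht : 0 ≤ t) : Tendsto (fun n => ⌊t / τ n⌋₊ * τ n) atTop (𝓝 t) := by
  have hinv : Tendsto (fun n => (τ n)⁻¹) atTop atTop :=
    (tendsto_nhdsWithin_iff.2 ⟨hτ0, Eventually.of_forall hτ⟩).inv_tendsto_nhdsGT_zero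
  refine ((tendsto_nat_floor_mul_div_atTop ht).comp hinv).congr fun n => ?_
  simp only [Function.comp_apply, div_inv_eq_mul, ← div_eq_mul_inv]

namespace IsEuler

variable {u ξ y ζ : ℕ → H}

theorem norm_interp_sub_le (h : IsEuler D e τ u ξ) (hτ : 0 < τ) {s t : ℝ} (hst : s ≤ t) :
    ‖interp τ u t - interp τ u s‖ ≤ ‖ξ 0‖ * (⌊t / τ⌋₊ * τ - ⌊s / τ⌋₊ * τ) := by
  obtain ⟨i, hi⟩ :=
    Nat.exists_eq_add_of_le (Nat.floor_le_floor (div_le_div_of_nonneg_right hst hτ.le))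
  simp only [interp, hi]
  refine (h.norm_add_sub_le hτ _ _).trans_eq ?_
  push_cast
  ring

theorem evi_interp (h : IsEuler D e τ u ξ) (hτ : 0 < τ) {v : H} (hv : v ∈ D) {s t : ℝ}
    (hst : s ≤ t) : ‖interp τ u t - v‖ ^ 2 / 2 - ‖interp τ u s - v‖ ^ 2 / 2 ≤
      (⌊t / τ⌋₊ * τ - ⌊s / τ⌋₊ * τ) * (e v - e (interp τ u t)) := by
  obtain ⟨i, hi⟩ :=
    Nat.exists_eq_add_of_le (Nat.floor_le_floor (div_le_div_of_nonneg_right hst hτ.le))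
  simp only [interp, hi]
  refine (h.evi hτ hv _ _).trans_eq ?_
  push_cast
  ring

theorem norm_interp_sub_interp_half_le (h : IsEuler D e τ u ξ) (hτ : 0 < τ)
    (hy : IsEuler D e (τ / 2) y ζ) (h0 : u 0 = y 0) {M : ℝ} (hξ : ‖ξ 0‖ ≤ M) (hζ : ‖ζ 0‖ ≤ M)
    {t : ℝ} (ht : 0 ≤ t) :
    ‖interp τ u t - interp (τ / 2) y t‖ ≤ M * √t * √τ + M * τ := by
  have hM : 0 ≤ M := (norm_nonneg _).trans hξ
  set k := ⌊t / τ⌋₊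
  have hkτ : k * τ ≤ t := (le_div_iff₀ hτ).1 (Nat.floor_le (div_nonneg ht hτ.le))
  have hcoarse : ‖u k - y (2 * k)‖ ≤ M * √t * √τ := by
    rw [mul_assoc, ← Real.sqrt_mul ht]
    refine le_of_sq_le_sq ((h.norm_sub_half_le hτ hy h0 hξ hζ k).trans ?_) (by positivity)
    rw [mul_pow M, Real.sq_sqrt (mul_nonneg ht hτ.le)]
    calc (k : ℝ) * (τ * M) ^ 2 = (k * τ) * (τ * M ^ 2) := by ring
      _ ≤ t * (τ * M ^ 2) := by gcongr
      _ = M ^ 2 * (t * τ) := by ring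
  have hfine : ‖y (2 * k) - interp (τ / 2) y t‖ ≤ M * τ := by
    have hstep : ‖y (2 * k) - y (2 * k + 1)‖ ≤ M * τ := by
      rw [norm_sub_rev]
      refine (hy.norm_succ_sub_le (half_pos hτ) _).trans ?_
      rw [mul_comm M]
      exact mul_le_mul (half_le_self hτ.le) hζ (norm_nonneg _) hτ.le
    have hdouble : t / (τ / 2) = t / τ * 2 := by field_simp
    rw [interp, hdouble]
    rcases floor_mul_two_eq_or _ (div_nonneg ht hτ.le) with heven | hodd
    · rw [heven, sub_self, norm_zero]; positivity
    · rwa [hodd]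
  exact (norm_sub_le_norm_sub_add_norm_sub _ (y (2 * k)) _).trans (add_le_add hcoarse hfine)

end IsEuler

theorem exists_tendsto_interp_dyadic [CompleteSpace H] {u ξ : ℕ → ℕ → H} {x₀ : H} {M : ℝ}
    (hu : ∀ n, IsEuler D e ((1 / 2) ^ n) (u n) (ξ n)) (hu0 : ∀ n, u n 0 = x₀)
    (hξ : ∀ n, ‖ξ n 0‖ ≤ M) {t : ℝ} (ht : 0 ≤ t) :
    ∃ z, Tendsto (fun n => interp ((1 / 2) ^ n) (u n) t) atTop (𝓝 z) := by
  have hM : 0 ≤ M := (norm_nonneg _).trans (hξ 0)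
  refine cauchySeq_tendsto_of_complete <| cauchySeq_of_le_geometric (√(1 / 2)) (M * √t + M)
    (by rw [Real.sqrt_lt' one_pos]; norm_num) fun n => ?_
  set τ : ℝ := (1 / 2) ^ n
  have hτ : 0 < τ := by positivity
  have hτ1 : τ ≤ 1 := pow_le_one₀ one_half_pos.le one_half_lt_one.le
  have hhalf : (1 / 2 : ℝ) ^ (n + 1) = τ / 2 := by rw [pow_succ, mul_one_div]
  have hsqrt : √(1 / 2) ^ n = √τ := (Real.sqrt_eq_iff_mul_self_eq hτ.le (by positivity)).2
    (by rw [← mul_pow, Real.mul_self_sqrt one_half_pos.le]) |>.symm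
  have hτ_le : τ ≤ √τ := (Real.le_sqrt' hτ).2 (by nlinarith)
  rw [dist_eq_norm, hhalf, hsqrt]
  refine ((hu n).norm_interp_sub_interp_half_le hτ (hhalf ▸ hu (n + 1)) (by rw [hu0, hu0])
    (hξ n) (hξ (n + 1)) ht).trans ?_
  rw [add_mul]
  gcongr

theorem isEVISolution_of_tendsto_interp (hcl : ∀ K, IsClosed {x | x ∈ D ∧ e x ≤ K})
    {τ : ℕ → ℝ} (hτ : ∀ n, 0 < τ n) (hτ0 : Tendsto τ atTop (𝓝 0)) {u ξ : ℕ → ℕ → H} {x₀ : H}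
    (hu : ∀ n, IsEuler D e (τ n) (u n) (ξ n)) (hu0 : ∀ n, u n 0 = x₀) {w : ℝ → H}
    (hw : ∀ t, 0 ≤ t → Tendsto (fun n => interp (τ n) (u n) t) atTop (𝓝 (w t))) :
    IsEVISolution D e w := by
  have hmem (n : ℕ) (t : ℝ) : interp (τ n) (u n) t ∈ D := ((hu n).subgrad _).1
  refine ⟨fun t ht => ?_, fun v hv s t hs hst => ?_⟩
  · refine (mem_and_le_of_tendsto hcl (hw t ht) (fun n => hmem n t) (k := fun _ => e x₀)
      (Eventually.of_forall fun n => ?_) tendsto_const_nhds).1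
    exact hu0 n ▸ (hu n).energy_antitone (hτ n) (Nat.zero_le _)
  · have ht := hs.trans hst.le
    set Δ : ℕ → ℝ := fun n => ⌊t / τ n⌋₊ * τ n - ⌊s / τ n⌋₊ * τ n
    have hΔ : Tendsto Δ atTop (𝓝 (t - s)) :=
      (tendsto_floor_div_mul hτ hτ0 ht).sub (tendsto_floor_div_mul hτ hτ0 hs)
    have hdist {r : ℝ} (hr : 0 ≤ r) : Tendsto (fun n => ‖interp (τ n) (u n) r - v‖ ^ 2 / 2) atTop
        (𝓝 (‖w r - v‖ ^ 2 / 2)) := (((hw r hr).sub_const v).norm.pow 2).div_const 2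
    have hlim := tendsto_const_nhds (x := e v) |>.sub
      (((hdist ht).sub (hdist hs)).div hΔ (sub_pos.2 hst).ne')
    have hbound := (mem_and_le_of_tendsto hcl (hw t ht) (fun n => hmem n t) (by
      filter_upwards [hΔ.eventually_const_lt (sub_pos.2 hst)] with n hn
      rw [le_sub_comm, Pi.div_apply, div_le_iff₀ hn, mul_comm]
      exact (hu n).evi_interp (hτ n) hv hst.le) hlim).2
    rwa [le_sub_comm, div_le_iff₀ (sub_pos.2 hst), mul_comm] at hbound

theorem lipschitzOnWith_of_tendsto_interp {τ : ℕ → ℝ} (hτ : ∀ n, 0 < τ n)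
    (hτ0 : Tendsto τ atTop (𝓝 0)) {u ξ : ℕ → ℕ → H} {ξ₀ : H}
    (hu : ∀ n, IsEuler D e (τ n) (u n) (ξ n)) (hξ0 : ∀ n, ξ n 0 = ξ₀) {w : ℝ → H}
    (hw : ∀ t, 0 ≤ t → Tendsto (fun n => interp (τ n) (u n) t) atTop (𝓝 (w t))) :
    LipschitzOnWith ‖ξ₀‖₊ w (Ici 0) := by
  refine LipschitzOnWith.of_dist_le_mul fun t ht s hs => ?_
  wlog hst : s ≤ t generalizing s t
  · rw [dist_comm, dist_comm t]; exact this s hs t ht (le_of_not_ge hst)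
  rw [dist_eq_norm, Real.dist_eq, abs_of_nonneg (sub_nonneg.2 hst), coe_nnnorm]
  refine le_of_tendsto_of_tendsto' ((hw t ht).sub (hw s hs)).norm
    (((tendsto_floor_div_mul hτ hτ0 ht).sub (tendsto_floor_div_mul hτ hτ0 hs)).const_mul _)
    fun n => ?_
  exact hξ0 n ▸ (hu n).norm_interp_sub_le (hτ n) hst

theorem IsSubgradient.exists_isEVISolution [CompleteSpace H] {x₀ ξ₀ : H}
    (h₀ : IsSubgradient D e x₀ ξ₀) (hconv : ConvexOn ℝ D e)
    (hcl : ∀ K, IsClosed {x | x ∈ D ∧ e x ≤ K}) :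
    ∃ w : ℝ → H, w 0 = x₀ ∧ LipschitzWith ‖ξ₀‖₊ w ∧ (∀ t, w t ∈ D) ∧ IsEVISolution D e w := by
  have hτ (n : ℕ) : 0 < (1 / 2 : ℝ) ^ n := by positivity
  have hτ0 : Tendsto (fun n : ℕ => (1 / 2 : ℝ) ^ n) atTop (𝓝 0) :=
    tendsto_pow_atTop_nhds_zero_of_lt_one one_half_pos.le one_half_lt_one
  choose u ξ hu hu0 hξ0 using fun n => h₀.exists_isEuler hconv hcl (hτ n)
  choose! w hw using fun t (ht : 0 ≤ t) =>
    exists_tendsto_interp_dyadic hu hu0 (fun n => (congrArg norm (hξ0 n)).le) ht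
  have hlip := lipschitzOnWith_of_tendsto_interp hτ hτ0 hu hξ0 hw
  have hevi := isEVISolution_of_tendsto_interp hcl hτ hτ0 hu hu0 hw
  have hpos (t : ℝ) : 0 ≤ max t 0 := le_max_right t 0
  refine ⟨fun t => w (max t 0), tendsto_nhds_unique (hw _ (hpos 0)) ?_,
    LipschitzWith.of_dist_le_mul fun s t => ?_, fun t => hevi.mem _ (hpos t),
    fun t _ => hevi.mem _ (hpos t), fun v hv s t hs hst => ?_⟩
  · simp only [max_self, interp, zero_div, Nat.floor_zero, hu0, tendsto_const_nhds]
  · refine (hlip.dist_le_mul _ (hpos s) _ (hpos t)).trans ?_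
    gcongr
    exact abs_max_sub_max_le_abs s t 0
  · rw [max_eq_left hs, max_eq_left (hs.trans hst.le)]
    exact hevi.evi v hv s t hs hst

theorem IsEVISolution.isSubgradient_neg_deriv {w : ℝ → H} (hw : IsEVISolution D e w) {t : ℝ}
    (ht : 0 < t) {w' : H} (hderiv : HasDerivAt w w' t) : IsSubgradient D e (w t) (-w') := by
  refine ⟨hw.mem t ht.le, fun v hv => ?_⟩
  have hsq : HasDerivAt (fun s => ‖w s - v‖ ^ 2) (2 * ⟪w t - v, w'⟫) t :=
    (hderiv.sub_const v).norm_sq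
  have hle : 2 * ⟪w t - v, w'⟫ ≤ 2 * (e v - e (w t)) := by
    refine le_of_tendsto (hasDerivAt_iff_tendsto_slope_left_right.1 hsq).1 ?_
    filter_upwards [Ioo_mem_nhdsLT ht] with s ⟨hs0, hst⟩
    have hevi := hw.evi v hv s t hs0.le hst
    rw [slope_comm, slope_def_field, div_le_iff₀ (sub_pos.2 hst)]
    linarith
  have hneg : ⟪-w', v - w t⟫ = ⟪w t - v, w'⟫ := by
    rw [inner_neg_left, ← inner_neg_right, neg_sub, real_inner_comm]
  linarith

end Limit

end ConvexFlow

namespace CurveCalculus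

open Filter Topology
open scoped RealInnerProductSpace NNReal

section AbsolutelyContinuous

variable {F : Type*} [NormedAddCommGroup F] {f : ℝ → F} {a b : ℝ}

theorem absolutelyContinuousOnInterval_of_dist_le {X Y : Type*} [PseudoMetricSpace X]
    [PseudoMetricSpace Y] {f : ℝ → X} {g : ℝ → Y} (hg : AbsolutelyContinuousOnInterval g a b)
    (hfg : ∀ x ∈ uIcc a b, ∀ y ∈ uIcc a b, dist (f x) (f y) ≤ dist (g x) (g y)) :
    AbsolutelyContinuousOnInterval f a b := by
  refine squeeze_zero' (Eventually.of_forall fun _ => Finset.sum_nonneg fun _ _ => dist_nonneg)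
    ?_ hg
  filter_upwards [mem_inf_of_right (mem_principal_self _)] with E hE
  exact Finset.sum_le_sum fun i hi => hfg _ (hE.1 i hi).1 _ (hE.1 i hi).2

theorem absolutelyContinuousOnInterval_norm (hf : AbsolutelyContinuousOnInterval f a b) :
    AbsolutelyContinuousOnInterval (fun x => ‖f x‖) a b :=
  absolutelyContinuousOnInterval_of_dist_le hf fun x _ y _ =>
    (dist_norm_norm_le (f x) (f y)).trans_eq (dist_eq_norm _ _).symm

variable [NormedSpace ℝ F]

theorem absolutelyContinuousOnInterval_integral (hf : IntervalIntegrable f volume a b) :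
    AbsolutelyContinuousOnInterval (fun x => ∫ t in a..x, f t) a b := by
  refine absolutelyContinuousOnInterval_of_dist_le
    (hf.norm.absolutelyContinuousOnInterval_intervalIntegral left_mem_uIcc) fun x hx y hy => ?_
  have hfz {z : ℝ} (hz : z ∈ uIcc a b) : IntervalIntegrable f volume a z :=
    hf.mono_set (uIcc_subset_uIcc_left hz)
  rw [dist_eq_norm, dist_eq_norm, intervalIntegral.integral_interval_sub_left (hfz hx) (hfz hy),
    intervalIntegral.integral_interval_sub_left (hfz hx).norm (hfz hy).norm]
  exact intervalIntegral.norm_integral_le_abs_integral_norm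

theorem integral_eq_sub_of_ae_hasDerivAt [CompleteSpace F] {f' : ℝ → F}
    (hf : AbsolutelyContinuousOnInterval f a b)
    (hderiv : ∀ᵐ x, x ∈ uIcc a b → HasDerivAt f (f' x) x)
    (hint : IntervalIntegrable f' volume a b) : ∫ t in a..b, f' t = f b - f a := by
  have hI := absolutelyContinuousOnInterval_integral hint
  obtain ⟨c, hc⟩ := (hf.sub hI).const_of_ae_hasDerivAt_zero (by
    filter_upwards [hderiv, hint.ae_hasDerivAt_integral] with x hfx hIx hx
    simpa only [sub_self] using (hfx hx).sub (hIx hx a left_mem_uIcc))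
  have hconst : f b - ∫ t in a..b, f' t = f a - ∫ t in a..a, f' t :=
    (hc b right_mem_uIcc).trans (hc a left_mem_uIcc).symm
  rw [intervalIntegral.integral_same, sub_zero] at hconst
  rw [← hconst, sub_sub_cancel]

theorem integral_deriv_smul_eq_neg [CompleteSpace F] {f' : ℝ → F}
    (hf : AbsolutelyContinuousOnInterval f a b)
    (hderiv : ∀ᵐ x, x ∈ uIcc a b → HasDerivAt f (f' x) x)
    (hint : IntervalIntegrable f' volume a b) {θ : ℝ → ℝ} (hθ : ContDiff ℝ 1 θ)
    (ha : θ a = 0) (hb : θ b = 0) :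
    ∫ t in a..b, deriv θ t • f t = -∫ t in a..b, θ t • f' t := by
  have hac : AbsolutelyContinuousOnInterval (θ • f) a b :=
    hθ.contDiffOn.absolutelyContinuousOnInterval.smul hf
  have hθf' : IntervalIntegrable (fun t => θ t • f' t) volume a b :=
    hint.continuousOn_smul hθ.continuous.continuousOn
  have hθ'f : IntervalIntegrable (fun t => deriv θ t • f t) volume a b :=
    ((hθ.continuous_deriv le_rfl).continuousOn.smul hf.continuousOn).intervalIntegrable
  have hftc := integral_eq_sub_of_ae_hasDerivAt hac (hderiv.mono fun x hx hxab =>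
    (hθ.differentiable one_ne_zero x).hasDerivAt.smul (hx hxab)) (hθf'.add hθ'f)
  rw [intervalIntegral.integral_add hθf' hθ'f, Pi.smul_apply', Pi.smul_apply', ha, hb, zero_smul,
    zero_smul, sub_zero] at hftc
  exact eq_neg_of_add_eq_zero_right hftc

theorem eqOn_zero_of_inner_deriv_nonpos {H : Type*} [NormedAddCommGroup H] [InnerProductSpace ℝ H]
    {d d' : ℝ → H} (hd : AbsolutelyContinuousOnInterval d a b) (hab : a ≤ b)
    (hderiv : ∀ᵐ x, x ∈ Icc a b → HasDerivAt d (d' x) x)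
    (hle : ∀ᵐ x, x ∈ Icc a b → ⟪d x, d' x⟫ ≤ 0) (ha : d a = 0) : EqOn d 0 (Icc a b) := by
  intro t ht
  have hsub : Icc a t ⊆ Icc a b := Icc_subset_Icc_right ht.2
  have hnorm : AbsolutelyContinuousOnInterval (fun s => ‖d s‖) a t :=
    absolutelyContinuousOnInterval_norm (hd.mono (by rwa [uIcc_of_le ht.1, uIcc_of_le hab]))
  have hsq : AbsolutelyContinuousOnInterval (fun s => ‖d s‖ ^ 2) a t := by
    simpa only [sq] using hnorm.fun_mul hnorm
  have hdecr : ∫ x in a..t, deriv (fun s => ‖d s‖ ^ 2) x ≤ ∫ _ in a..t, (0 : ℝ) := by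
    refine intervalIntegral.integral_mono_ae_restrict ht.1 hsq.intervalIntegrable_deriv
      intervalIntegrable_const ((ae_restrict_iff' measurableSet_Icc).2 ?_)
    filter_upwards [hderiv, hle] with x hdx hlex hx
    rw [(hdx (hsub hx)).norm_sq.deriv]
    exact mul_nonpos_of_nonneg_of_nonpos two_pos.le (hlex (hsub hx))
  rw [hsq.integral_deriv_eq_sub, ha, intervalIntegral.integral_zero, norm_zero,
    zero_pow two_ne_zero, sub_zero] at hdecr
  exact norm_eq_zero.1 (pow_eq_zero_iff two_ne_zero |>.1 (hdecr.antisymm (sq_nonneg _)))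

end AbsolutelyContinuous

section WeakDerivative

theorem exists_primitive_testFunction {a b : ℝ} {p : ℝ → ℝ} (hp : ContDiff ℝ ∞ p)
    (hc : HasCompactSupport p) (hsupp : tsupport p ⊆ Ioo a b) (h0 : ∫ t, p t = 0) :
    ∃ θ : ℝ → ℝ, ContDiff ℝ ∞ θ ∧ HasCompactSupport θ ∧ tsupport θ ⊆ Ioo a b ∧ deriv θ = p := by
  rcases (tsupport p).eq_empty_or_nonempty with hempty | hne
  · obtain rfl : p = 0 := tsupport_eq_empty_iff.1 hempty
    exact ⟨0, contDiff_const, HasCompactSupport.zero, hsupp, deriv_const' 0⟩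
  obtain ⟨l, hl, hlow⟩ := hc.isCompact.exists_isLeast hne
  obtain ⟨u, hu, hhigh⟩ := hc.isCompact.exists_isGreatest hne
  have hint : Integrable p := hp.continuous.integrable_of_hasCompactSupport hc
  set θ : ℝ → ℝ := fun t => ∫ s in Iic t, p s
  have hθ : θ = fun t => (∫ s in Iic 0, p s) + ∫ s in (0 : ℝ)..t, p s := funext fun t => by
    rw [← intervalIntegral.integral_Iic_sub_Iic hint.integrableOn hint.integrableOn,
      add_sub_cancel]
  have hd (t : ℝ) : HasDerivAt θ (p t) t := by
    rw [hθ]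
    exact (hp.continuous.integral_hasStrictDerivAt 0 t).hasDerivAt.const_add _
  have hderiv : deriv θ = p := funext fun t => (hd t).deriv
  have hts : tsupport θ ⊆ Icc l u := by
    refine closure_minimal (Function.support_subset_iff'.2 fun t ht => ?_) isClosed_Icc
    rcases not_and_or.1 ht with hlt | hgt
    · exact setIntegral_eq_zero_of_forall_eq_zero fun s hs =>
        image_eq_zero_of_notMem_tsupport fun hmem => hlt ((hlow hmem).trans hs)
    · rw [← h0]
      exact setIntegral_eq_integral_of_forall_compl_eq_zero fun s hs =>
        image_eq_zero_of_notMem_tsupport fun hmem => hgt ((not_le.1 hs).le.trans (hhigh hmem))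
  refine ⟨θ, contDiff_infty_iff_deriv.2 ⟨fun t => (hd t).differentiableAt, hderiv ▸ hp⟩,
    isCompact_Icc.of_isClosed_subset (isClosed_tsupport θ) hts,
    hts.trans (Icc_subset_Ioo (hsupp hl).1 (hsupp hu).2), hderiv⟩

theorem exists_testFunction_integral_eq_one {a b : ℝ} (hab : a < b) :
    ∃ r : ℝ → ℝ, ContDiff ℝ ∞ r ∧ HasCompactSupport r ∧ tsupport r ⊆ Ioo a b ∧ ∫ t, r t = 1 := by
  let φ : ContDiffBump ((a + b) / 2 : ℝ) :=
    ⟨(b - a) / 8, (b - a) / 4, by linarith, by linarith⟩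
  refine ⟨φ.normed volume, φ.contDiff_normed, φ.hasCompactSupport_normed, ?_, φ.integral_normed⟩
  rw [φ.tsupport_normed_eq, Real.closedBall_eq_Icc]
  exact Icc_subset_Ioo (by simp only [φ]; linarith) (by simp only [φ]; linarith)

variable {F : Type*} [NormedAddCommGroup F] [NormedSpace ℝ F] {f : ℝ → F} {a b : ℝ}

theorem setIntegral_smul_eq_integral_of_tsupport_subset {p : ℝ → ℝ} (hp : tsupport p ⊆ Ioo a b)
    (g : ℝ → F) : ∫ t in Icc a b, p t • g t = ∫ t, p t • g t :=
  setIntegral_eq_integral_of_forall_compl_eq_zero fun t ht => by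
    rw [image_eq_zero_of_notMem_tsupport fun hmem => ht (Ioo_subset_Icc_self (hp hmem)), zero_smul]

/- Subtracting the multiple of a test function of mass one that has the same mean turns any test
function into a derivative of a test function. -/
theorem integral_smul_eq_of_integral_deriv_smul_eq_zero (hf : ContinuousOn f (Icc a b))
    (hzero : ∀ θ : ℝ → ℝ, ContDiff ℝ ∞ θ → HasCompactSupport θ → tsupport θ ⊆ Ioo a b →
      ∫ t in Icc a b, deriv θ t • f t = 0) {r p : ℝ → ℝ} (hr : ContDiff ℝ ∞ r)
    (hrc : HasCompactSupport r) (hrs : tsupport r ⊆ Ioo a b) (hr1 : ∫ t, r t = 1)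
    (hp : ContDiff ℝ ∞ p) (hpc : HasCompactSupport p) (hps : tsupport p ⊆ Ioo a b) :
    ∫ t in Icc a b, p t • f t = (∫ t, p t) • ∫ t in Icc a b, r t • f t := by
  obtain ⟨m, hm⟩ : ∃ m, ∫ t, p t = m := ⟨_, rfl⟩
  have hpi := hp.continuous.integrable_of_hasCompactSupport (μ := volume) hpc
  have hri := hr.continuous.integrable_of_hasCompactSupport (μ := volume) hrc
  have hsupp : tsupport (fun t => p t - m * r t) ⊆ Ioo a b :=
    (tsupport_sub p fun t => m * r t).trans
      (union_subset hps ((tsupport_smul_subset_right (fun _ => m) r).trans hrs))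
  have hmean : ∫ t, (p t - m * r t) = 0 := by
    rw [integral_sub hpi (hri.const_mul m), integral_const_mul, hr1, mul_one, hm, sub_self]
  obtain ⟨θ, hθ, hθc, hθs, hθ'⟩ := exists_primitive_testFunction
    (hp.sub (contDiff_const.mul hr)) (hpc.sub hrc.mul_left) hsupp hmean
  have hint {q : ℝ → ℝ} (hq : Continuous q) : IntegrableOn (fun t => q t • f t) (Icc a b) :=
    (hq.continuousOn.smul hf).integrableOn_Icc
  have hθf := hzero θ hθ hθc hθs
  simp only [hθ', sub_smul, mul_smul] at hθf
  have hrm : IntegrableOn (fun t => m • r t • f t) (Icc a b) := (hint hr.continuous).smul m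
  rw [integral_sub (hint hp.continuous) hrm, integral_smul] at hθf
  rw [hm, sub_eq_zero.1 hθf]

variable [CompleteSpace F]

theorem exists_eqOn_const_of_integral_deriv_smul_eq_zero (hab : a < b)
    (hf : ContinuousOn f (Icc a b))
    (hzero : ∀ θ : ℝ → ℝ, ContDiff ℝ ∞ θ → HasCompactSupport θ → tsupport θ ⊆ Ioo a b →
      ∫ t in Icc a b, deriv θ t • f t = 0) : ∃ c, EqOn f (fun _ => c) (Icc a b) := by
  obtain ⟨r, hr, hrc, hrs, hr1⟩ := exists_testFunction_integral_eq_one hab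
  set c := ∫ t in Icc a b, r t • f t
  have hfc : ContinuousOn (fun t => f t - c) (Icc a b) := hf.sub continuousOn_const
  have hae : ∀ᵐ t, t ∈ Ioo a b → f t - c = 0 := by
    refine isOpen_Ioo.ae_eq_zero_of_integral_contDiff_smul_eq_zero
      (hfc.integrableOn_Icc.locallyIntegrableOn.mono_set Ioo_subset_Icc_self) fun p hp hpc hps => ?_
    have hpi := hp.continuous.integrable_of_hasCompactSupport (μ := volume) hpc
    have hpf : IntegrableOn (fun t => p t • f t) (Icc a b) :=
      (hp.continuous.continuousOn.smul hf).integrableOn_Icc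
    rw [← setIntegral_smul_eq_integral_of_tsupport_subset hps]
    simp only [smul_sub]
    rw [integral_sub hpf (hpi.smul_const c).integrableOn,
      setIntegral_smul_eq_integral_of_tsupport_subset hps (fun _ => c), integral_smul_const,
      sub_eq_zero]
    exact integral_smul_eq_of_integral_deriv_smul_eq_zero hf hzero hr hrc hrs hr1 hp hpc hps
  refine ⟨c, Measure.eqOn_Icc_of_ae_eq volume hab.ne ?_ hf continuousOn_const⟩
  rw [← Measure.restrict_congr_set Ioo_ae_eq_Icc]
  exact (ae_restrict_iff' measurableSet_Ioo).2 <| hae.mono fun t ht htab => sub_eq_zero.1 (ht htab)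

theorem eq_add_integral_of_weakDeriv (hab : a < b) {f' : ℝ → F} (hf : ContinuousOn f (Icc a b))
    (hint : IntervalIntegrable f' volume a b)
    (hweak : ∀ θ : ℝ → ℝ, ContDiff ℝ ∞ θ → HasCompactSupport θ → tsupport θ ⊆ Ioo a b →
      ∫ t in Icc a b, deriv θ t • f t = -∫ t in Icc a b, θ t • f' t) :
    ∀ t ∈ Icc a b, f t = f a + ∫ s in a..t, f' s := by
  set G : ℝ → F := fun t => ∫ s in a..t, f' s
  have hG : AbsolutelyContinuousOnInterval G a b := absolutelyContinuousOnInterval_integral hint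
  have hGc : ContinuousOn G (Icc a b) := uIcc_of_le hab.le ▸ hG.continuousOn
  have hG' : ∀ᵐ x, x ∈ uIcc a b → HasDerivAt G (f' x) x :=
    hint.ae_hasDerivAt_integral.mono fun x hx hxab => hx hxab a left_mem_uIcc
  obtain ⟨c, hc⟩ := exists_eqOn_const_of_integral_deriv_smul_eq_zero (f := fun t => f t - G t) hab
    (hf.sub hGc) fun θ hθ hθc hθs => by
      have hθ' : ContinuousOn (deriv θ) (Icc a b) := (hθ.continuous_deriv (by simp)).continuousOn
      have hθ0 {x : ℝ} (hx : x ∉ Ioo a b) : θ x = 0 :=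
        image_eq_zero_of_notMem_tsupport fun hmem => hx (hθs hmem)
      have hparts := integral_deriv_smul_eq_neg hG hG' hint (hθ.of_le (by simp))
        (hθ0 left_notMem_Ioo) (hθ0 right_notMem_Ioo)
      simp only [intervalIntegral.integral_of_le hab.le, ← integral_Icc_eq_integral_Ioc] at hparts
      have hθ'int {g : ℝ → F} (hg : ContinuousOn g (Icc a b)) :
          IntegrableOn (fun t => deriv θ t • g t) (Icc a b) := (hθ'.smul hg).integrableOn_Icc
      simp only [smul_sub]
      rw [integral_sub (hθ'int hf) (hθ'int hGc), hweak θ hθ hθc hθs, hparts, sub_self]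
  intro t ht
  have hconst : f t - G t = f a - G a := (hc ht).trans (hc (left_mem_Icc.2 hab.le)).symm
  rw [← sub_eq_iff_eq_add, hconst, sub_eq_self]
  exact intervalIntegral.integral_same

end WeakDerivative

section Rademacher

variable {H : Type*} [NormedAddCommGroup H] [InnerProductSpace ℝ H]

theorem countable_of_orthonormal [SecondCountableTopology H] {ι : Type*} {v : ι → H}
    (hv : Orthonormal ℝ v) : Countable ι := by
  refine Pairwise.countable_of_isOpen_disjoint (s := fun i => Metric.ball (v i) (1 / 2))
    (fun i j hij => Metric.ball_disjoint_ball ?_) (fun i => Metric.isOpen_ball)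
    (fun i => ⟨v i, Metric.mem_ball_self one_half_pos⟩)
  have hdist : ‖v i - v j‖ ^ 2 = 2 := by
    rw [norm_sub_sq_real, hv.2 hij, hv.1 i, hv.1 j]
    norm_num
  rw [dist_eq_norm]
  nlinarith only [hdist, norm_nonneg (v i - v j)]

variable {K : ℝ≥0} {w : ℝ → H} {ι : Type*}

theorem lipschitzWith_inner_left (hw : LipschitzWith K w) (x : H) :
    LipschitzWith (‖innerSL ℝ x‖₊ * K) fun t => ⟪x, w t⟫ :=
  (innerSL ℝ x).lipschitz.comp hw

theorem sum_sq_deriv_inner_le (hw : LipschitzWith K w) {v : ι → H} (hv : Orthonormal ℝ v) (t : ℝ)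
    (s : Finset ι) : ∑ i ∈ s, ‖deriv (fun r => ⟪v i, w r⟫) t‖ ^ 2 ≤ (K : ℝ) ^ 2 := by
  classical
  rw [← Finset.sum_filter_of_ne (p := fun i => DifferentiableAt ℝ (fun r => ⟪v i, w r⟫) t)
    fun i _ hi => not_imp_comm.1 deriv_zero_of_not_differentiableAt
      fun hzero => hi (by rw [hzero, norm_zero, zero_pow two_ne_zero])]
  refine le_of_tendsto (tendsto_finsetSum _ fun i hi => (hasDerivAt_iff_tendsto_slope.1
    (Finset.mem_filter.1 hi).2.hasDerivAt).norm.pow 2) ?_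
  filter_upwards [self_mem_nhdsWithin] with y hy
  have hslope (i : ι) : slope (fun r => ⟪v i, w r⟫) t y = ⟪v i, slope w t y⟫ := by
    rw [slope_def_module, slope_def_module, inner_smul_right, inner_sub_right, smul_eq_mul]
  simp only [hslope]
  refine (hv.sum_inner_products_le _).trans (pow_le_pow_left₀ (norm_nonneg _) ?_ 2)
  rw [slope_def_module, norm_smul, norm_inv, inv_mul_le_iff₀ (norm_pos_iff.2 (sub_ne_zero.2 hy)),
    mul_comm, ← dist_eq_norm, ← dist_eq_norm]
  exact hw.dist_le_mul y t

/-- The derivative of a Lipschitz curve assembled from the derivatives of its coordinates in a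
Hilbert basis (`0` for the coordinates that are not differentiable). It is defined at every time. -/
noncomputable def basisDeriv (b : HilbertBasis ι ℝ H) (hw : LipschitzWith K w) (t : ℝ) : H :=
  b.repr.symm ⟨fun i => deriv (fun r => ⟪b i, w r⟫) t, memℓp_gen' (C := (K : ℝ) ^ 2) fun s => by
    simpa only [ENNReal.toReal_ofNat, Real.rpow_ofNat] using
      sum_sq_deriv_inner_le hw b.orthonormal t s⟩

variable (b : HilbertBasis ι ℝ H) (hw : LipschitzWith K w)

theorem inner_basisDeriv (t : ℝ) (i : ι) :
    ⟪b i, basisDeriv b hw t⟫ = deriv (fun r => ⟪b i, w r⟫) t := by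
  rw [← b.repr_apply_apply, basisDeriv, LinearIsometryEquiv.apply_symm_apply]

theorem norm_basisDeriv_le (t : ℝ) : ‖basisDeriv b hw t‖ ≤ K := by
  rw [basisDeriv, LinearIsometryEquiv.norm_map]
  refine lp.norm_le_of_forall_sum_le (by norm_num) K.2 fun s => ?_
  simp only [ENNReal.toReal_ofNat, Real.rpow_ofNat]
  exact sum_sq_deriv_inner_le hw b.orthonormal t s

theorem stronglyMeasurable_basisDeriv [Countable ι] : StronglyMeasurable (basisDeriv b hw) := by
  refine stronglyMeasurable_of_tendsto (atTop : Filter (Finset ι))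
    (f := fun s t => ∑ i ∈ s, deriv (fun r => ⟪b i, w r⟫) t • b i) (fun s => ?_)
    (tendsto_pi_nhds.2 fun t => b.hasSum_repr_symm _)
  exact Finset.stronglyMeasurable_fun_sum _ fun i _ => (stronglyMeasurable_deriv _).smul_const _

theorem locallyIntegrable_basisDeriv [Countable ι] :
    LocallyIntegrable (basisDeriv b hw) :=
  (locallyIntegrable_const (K : ℝ)).mono (stronglyMeasurable_basisDeriv b hw).aestronglyMeasurable
    (Eventually.of_forall fun t => by
      simpa only [NNReal.norm_eq] using norm_basisDeriv_le b hw t)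

theorem eq_add_integral_basisDeriv [CompleteSpace H] [Countable ι] (x : ℝ) :
    w x = w 0 + ∫ t in (0 : ℝ)..x, basisDeriv b hw t := by
  refine b.repr.injective (lp.ext (funext fun i => ?_))
  have hint : IntervalIntegrable (basisDeriv b hw) volume 0 x :=
    ((locallyIntegrable_basisDeriv b hw).integrableOn_isCompact isCompact_uIcc).intervalIntegrable
  have hcoord : ⟪b i, ∫ t in (0 : ℝ)..x, basisDeriv b hw t⟫ = ⟪b i, w x⟫ - ⟪b i, w 0⟫ := by
    rw [← innerSL_apply_apply ℝ, ← ContinuousLinearMap.intervalIntegral_comp_comm _ hint]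
    simp only [innerSL_apply_apply, inner_basisDeriv]
    exact (lipschitzWith_inner_left hw (b i)).lipschitzOnWith.absolutelyContinuousOnInterval
      |>.integral_deriv_eq_sub
  rw [b.repr_apply_apply, b.repr_apply_apply, inner_add_right, hcoord, add_sub_cancel]

include hw in
theorem ae_differentiableAt_of_lipschitzWith [CompleteSpace H] [SecondCountableTopology H] :
    ∀ᵐ t, DifferentiableAt ℝ w t := by
  obtain ⟨s, b, -⟩ := exists_hilbertBasis ℝ H
  have := countable_of_orthonormal b.orthonormal
  filter_upwards [LocallyIntegrable.ae_hasDerivAt_integral (locallyIntegrable_basisDeriv b hw)]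
    with t ht
  rw [funext (eq_add_integral_basisDeriv b hw)]
  exact ((ht 0).const_add _).differentiableAt

end Rademacher

end CurveCalculus

namespace MeasureDuality

open Filter Topology
open scoped NNReal

section SignedMeasureIntegral

variable {X : Type*} [MeasurableSpace X]

theorem abs_integral_signedMeasure_le {f : X → ℝ} {A : ℝ} (hf : ∀ x, |f x| ≤ A)
    (σ : SignedMeasure X) : |∫ᵛ x, f x ∂<•σ| ≤ A * σ.totalVariation.real univ := by
  have hfin : IsFiniteMeasure σ.variation := by
    rw [← SignedMeasure.totalVariation_eq_variation]
    infer_instance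
  have hle := VectorMeasure.norm_integral_le_of_norm_le_const (μ := σ)
    (B := (ContinuousLinearMap.lsmul ℝ ℝ).flip) (f := f) (Eventually.of_forall hf)
  rwa [ContinuousLinearMap.opNorm_flip, ContinuousLinearMap.opNorm_lsmul, mul_one,
    ← SignedMeasure.totalVariation_eq_variation] at hle

variable [TopologicalSpace X] [CompactSpace X] [OpensMeasurableSpace X] {f : X → ℝ}

theorem integrable_of_continuous (hf : Continuous f) (μ : Measure X) [IsFiniteMeasure μ] :
    Integrable f μ :=
  hf.integrable_of_hasCompactSupport (HasCompactSupport.of_compactSpace f)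

theorem integrable_signedMeasure_of_continuous (hf : Continuous f) (σ : SignedMeasure X) :
    σ.Integrable f := by
  rw [VectorMeasure.Integrable, ← SignedMeasure.totalVariation_eq_variation]
  exact integrable_of_continuous hf _

theorem integral_toSignedMeasure_sub (hf : Continuous f) (μ ν : Measure X)
    [IsFiniteMeasure μ] [IsFiniteMeasure ν] :
    ∫ᵛ x, f x ∂<•(μ.toSignedMeasure - ν.toSignedMeasure) = ∫ x, f x ∂μ - ∫ x, f x ∂ν := by
  rw [VectorMeasure.integral_sub_vectorMeasure (integrable_signedMeasure_of_continuous hf _)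
    (integrable_signedMeasure_of_continuous hf _), VectorMeasure.integral_toSignedMeasure,
    VectorMeasure.integral_toSignedMeasure]

theorem integral_eq_posPart_sub_negPart (hf : Continuous f) (σ : SignedMeasure X) :
    ∫ᵛ x, f x ∂<•σ = ∫ x, f x ∂σ.toJordanDecomposition.posPart -
      ∫ x, f x ∂σ.toJordanDecomposition.negPart := by
  conv_lhs => rw [← σ.toSignedMeasure_toJordanDecomposition, JordanDecomposition.toSignedMeasure]
  exact integral_toSignedMeasure_sub hf _ _

theorem continuous_integral_signedMeasure (σ : SignedMeasure X) :
    Continuous fun f : C(X, ℝ) => ∫ᵛ x, f x ∂<•σ := by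
  refine (LipschitzWith.of_dist_le' (K := σ.totalVariation.real univ) fun f g => ?_).continuous
  rw [Real.dist_eq, ← VectorMeasure.integral_fun_sub
    (integrable_signedMeasure_of_continuous f.continuous σ)
    (integrable_signedMeasure_of_continuous g.continuous σ), mul_comm]
  exact abs_integral_signedMeasure_le
    (fun x => ContinuousMap.dist_apply_le_dist (f := f) (g := g) x) σ

theorem signedMeasure_ext_of_continuous [HasOuterApproxClosed X] [BorelSpace X]
    {σ τ : SignedMeasure X} (h : ∀ f : C(X, ℝ), ∫ᵛ x, f x ∂<•σ = ∫ᵛ x, f x ∂<•τ) : σ = τ := by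
  have hpos_neg : (σ - τ).toJordanDecomposition.posPart =
      (σ - τ).toJordanDecomposition.negPart := by
    refine ext_of_forall_integral_eq_of_IsFiniteMeasure fun f => sub_eq_zero.1 ?_
    have hf := integrable_signedMeasure_of_continuous f.continuous
    rw [← integral_eq_posPart_sub_negPart f.continuous,
      VectorMeasure.integral_sub_vectorMeasure (hf σ) (hf τ)]
    exact sub_eq_zero.2 (h f.toContinuousMap)
  rw [← sub_eq_zero, ← (σ - τ).toSignedMeasure_toJordanDecomposition,
    JordanDecomposition.toSignedMeasure, sub_eq_zero, Measure.toSignedMeasure_congr hpos_neg]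

end SignedMeasureIntegral

section FiniteMeasure

variable {X : Type*} [MeasurableSpace X] [TopologicalSpace X] [CompactSpace X]
  [OpensMeasurableSpace X] {f : X → ℝ}

theorem continuous_integral_finiteMeasure (hf : Continuous f) :
    Continuous fun μ : FiniteMeasure X => ∫ x, f x ∂(μ : Measure X) :=
  FiniteMeasure.continuous_integral_boundedContinuousFunction
    (BoundedContinuousFunction.mkOfCompact ⟨f, hf⟩)

theorem integral_smul_add_smul_finiteMeasure (hf : Continuous f) (a b : ℝ≥0)
    (μ ν : FiniteMeasure X) :
    ∫ x, f x ∂((a • μ + b • ν : FiniteMeasure X) : Measure X) =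
      a * ∫ x, f x ∂(μ : Measure X) + b * ∫ x, f x ∂(ν : Measure X) := by
  rw [FiniteMeasure.toMeasure_add, FiniteMeasure.toMeasure_smul, FiniteMeasure.toMeasure_smul,
    integral_add_measure (integrable_of_continuous hf _) (integrable_of_continuous hf _),
    integral_smul_nnreal_measure, integral_smul_nnreal_measure]
  rfl

theorem abs_integral_sub_integral_le (f g : C(X, ℝ)) (μ : Measure X) [IsFiniteMeasure μ] :
    |∫ x, f x ∂μ - ∫ x, g x ∂μ| ≤ dist f g * μ.real univ := by
  rw [← integral_sub (integrable_of_continuous f.continuous μ)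
    (integrable_of_continuous g.continuous μ), ← Real.norm_eq_abs]
  refine norm_integral_le_of_norm_le_const (Eventually.of_forall fun x => ?_)
  exact (Real.dist_eq (f x) (g x)).symm.trans_le (f.dist_apply_le_dist x)

theorem continuous_finiteMeasure_of_dense {Y : Type*} [TopologicalSpace Y] {μ : Y → FiniteMeasure X}
    {S : Set C(X, ℝ)} (hS : Dense S) {M : ℝ≥0} (hmass : ∀ y, (μ y).mass ≤ M)
    (hcont : ∀ f ∈ S, Continuous fun y => ∫ x, f x ∂(μ y : Measure X)) : Continuous μ := by
  rw [FiniteMeasure.continuous_iff_forall_continuousMap_continuous_integral]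
  intro f
  refine continuous_of_uniform_approx_of_continuous fun V hV => ?_
  obtain ⟨ε, hε, hεV⟩ := Metric.mem_uniformity_dist.1 hV
  obtain ⟨g, hg, hfg⟩ := hS.exists_dist_lt f (show 0 < ε / (M + 1) by positivity)
  refine ⟨_, hcont g hg, fun y => hεV ?_⟩
  have hmass' : (μ y : Measure X).real univ ≤ M := NNReal.coe_le_coe.2 (hmass y)
  calc dist (∫ x, f x ∂(μ y : Measure X)) (∫ x, g x ∂(μ y : Measure X))
      ≤ dist f g * (μ y : Measure X).real univ := abs_integral_sub_integral_le f g _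
    _ ≤ dist f g * (M + 1) := by gcongr; exact hmass'.trans (le_add_of_nonneg_right zero_le_one)
    _ < ε := (lt_div_iff₀ (by positivity)).1 hfg

theorem measurable_toMeasure_of_continuous {X Y : Type*} [TopologicalSpace X] [MeasurableSpace X]
    [BorelSpace X] [HasOuterApproxClosed X] [TopologicalSpace Y] [MeasurableSpace Y]
    [OpensMeasurableSpace Y] {μ : Y → FiniteMeasure X} (hμ : Continuous μ) :
    Measurable fun y => (μ y : Measure X) := by
  have hlint := FiniteMeasure.continuous_iff_forall_continuous_lintegral.1 hμ
  have hclosed (F : Set X) (hF : IsClosed F) : Measurable fun y => (μ y : Measure X) F := by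
    refine measurable_of_tendsto_metrizable (f := fun n y => ∫⁻ x, hF.apprSeq n x ∂(μ y))
      (fun n => (hlint _).measurable) ?_
    rw [tendsto_pi_nhds]
    exact fun y => HasOuterApproxClosed.tendsto_lintegral_apprSeq hF (μ y : Measure X)
  refine Measurable.measure_of_isPiSystem (S := {F | IsClosed F}) ?_ isPiSystem_isClosed hclosed
    (hclosed univ isClosed_univ)
  rw [BorelSpace.measurable_eq (α := X), borel_eq_generateFrom_isClosed]

end FiniteMeasure

section ContinuousApproximation

variable {X : Type*} [TopologicalSpace X] [MeasurableSpace X] [BorelSpace X]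

theorem tendsto_integral_of_continuous_of_bounded {μ : Measure X} [IsFiniteMeasure μ]
    {f : ℕ → X → ℝ} {g : X → ℝ} {A : ℝ} (hf : ∀ n, Continuous (f n)) (hb : ∀ n x, |f n x| ≤ A)
    (hlim : ∀ᵐ x ∂μ, Tendsto (fun n => f n x) atTop (𝓝 (g x))) :
    Tendsto (fun n => ∫ x, f n x ∂μ) atTop (𝓝 (∫ x, g x ∂μ)) :=
  tendsto_integral_of_dominated_convergence (fun _ => A)
    (fun n => (hf n).aestronglyMeasurable) (integrable_const A)
    (fun n => Eventually.of_forall (hb n)) hlim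

theorem exists_seq_continuous_tendsto_ae [NormalSpace X] (μ : Measure X) [IsFiniteMeasure μ]
    [μ.WeaklyRegular] {g : X → ℝ} (hg : Measurable g) {a b : ℝ} (hab : a ≤ b)
    (hgab : ∀ x, g x ∈ Icc a b) :
    ∃ f : ℕ → X → ℝ, (∀ n, Continuous (f n)) ∧ (∀ n x, f n x ∈ Icc a b) ∧
      ∀ᵐ x ∂μ, Tendsto (fun n => f n x) atTop (𝓝 (g x)) := by
  have hmem : MemLp g 1 μ := MemLp.of_bound hg.aestronglyMeasurable (max |a| |b|)
    (Eventually.of_forall fun x => abs_le_max_abs_abs (hgab x).1 (hgab x).2)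
  obtain ⟨ε, -, hε, hε0⟩ := exists_seq_strictAnti_tendsto' (zero_lt_one (α := ℝ≥0∞))
  choose f hf using fun n =>
    hmem.exists_boundedContinuous_eLpNorm_sub_le ENNReal.one_ne_top (hε n).1.ne'
  have hlim : Tendsto (fun n => eLpNorm ((f n : X → ℝ) - g) 1 μ) atTop (𝓝 0) :=
    tendsto_of_tendsto_of_tendsto_of_le_of_le tendsto_const_nhds hε0 (fun _ => zero_le)
      fun n => (eLpNorm_sub_comm _ _ _ _).trans_le (hf n).1
  obtain ⟨ns, -, hns⟩ := (tendstoInMeasure_of_tendsto_eLpNorm one_ne_zero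
    (fun n => (f n).continuous.aestronglyMeasurable) hg.aestronglyMeasurable
    hlim).exists_seq_tendsto_ae
  have hproj : Continuous fun y => (projIcc a b hab y : ℝ) :=
    continuous_subtype_val.comp continuous_projIcc
  refine ⟨fun n x => projIcc a b hab (f (ns n) x), fun n => hproj.comp (f (ns n)).continuous,
    fun n x => (projIcc a b hab (f (ns n) x)).2, hns.mono fun x hx => ?_⟩
  have hgx := (hproj.tendsto (g x)).comp hx
  rwa [projIcc_of_mem hab (hgab x)] at hgx

end ContinuousApproximation

section TotalVariation

variable {X : Type*} [MeasurableSpace X]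

theorem exists_measurable_sign (j : JordanDecomposition X) :
    ∃ s : X → ℝ, Measurable s ∧ (∀ x, s x ∈ Icc (-1) 1) ∧
      s =ᵐ[j.posPart] (fun _ => 1) ∧ s =ᵐ[j.negPart] fun _ => -1 := by
  classical
  obtain ⟨S, hS, hSpos, hSneg⟩ := j.mutuallySingular
  refine ⟨fun x => if x ∈ S then -1 else 1, Measurable.ite hS measurable_const measurable_const,
    fun x => ?_, ?_, ?_⟩
  · dsimp only
    split_ifs <;> norm_num
  · filter_upwards [measure_eq_zero_iff_ae_notMem.1 hSpos] with x hx using if_neg hx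
  · filter_upwards [measure_eq_zero_iff_ae_notMem.1 hSneg] with x hx using if_pos (not_not.1 hx)

theorem totalVariation_le_iff [TopologicalSpace X] [CompactSpace X]
    [TopologicalSpace.PseudoMetrizableSpace X] [BorelSpace X] {σ : SignedMeasure X} {C : ℝ} :
    σ.totalVariation.real univ ≤ C ↔
      ∀ f : X → ℝ, Continuous f → (∀ x, |f x| ≤ 1) → ∫ᵛ x, f x ∂<•σ ≤ C := by
  refine ⟨fun h f _ hf => ?_, fun h => ?_⟩
  · exact (le_abs_self _).trans <| (abs_integral_signedMeasure_le hf σ).trans <| by rwa [one_mul]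
  set j := σ.toJordanDecomposition
  obtain ⟨s, hs, hsb, hspos, hsneg⟩ := exists_measurable_sign j
  obtain ⟨f, hf, hfb, hfs⟩ := exists_seq_continuous_tendsto_ae (j.posPart + j.negPart) hs
    (by norm_num) hsb
  have hfb' (n : ℕ) (x : X) : |f n x| ≤ 1 := abs_le.2 (hfb n x)
  rw [ae_add_measure_iff] at hfs
  have hlim := (tendsto_integral_of_continuous_of_bounded hf hfb' hfs.1).sub
    (tendsto_integral_of_continuous_of_bounded hf hfb' hfs.2)
  have htv : σ.totalVariation.real univ = ∫ x, s x ∂j.posPart - ∫ x, s x ∂j.negPart := by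
    rw [integral_congr_ae hspos, integral_congr_ae hsneg, integral_const, integral_const,
      smul_eq_mul, smul_eq_mul, mul_one, mul_neg_one, sub_neg_eq_add,
      SignedMeasure.totalVariation, measureReal_add_apply]
  rw [htv]
  refine le_of_tendsto' hlim fun n => ?_
  rw [← integral_eq_posPart_sub_negPart (hf n)]
  exact h (f n) (hf n) (hfb' n)

end TotalVariation

section RadonNikodym

variable {X : Type*} [MeasurableSpace X] (μ ν : Measure X) [IsFiniteMeasure μ]

theorem toSignedMeasure_singularPart_mutuallySingular :
    (μ.singularPart ν).toSignedMeasure ⟂ᵥ ν.toENNRealVectorMeasure := by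
  obtain ⟨S, hS, hsing, hν⟩ := μ.mutuallySingular_singularPart ν
  refine VectorMeasure.MutuallySingular.mk S hS (fun t ht htm => ?_) fun t ht htm => ?_
  · rw [Measure.toSignedMeasure_apply_measurable htm, measureReal_def,
      measure_mono_null ht hsing, ENNReal.toReal_zero]
  · rw [Measure.toENNRealVectorMeasure_apply_measurable htm, measure_mono_null ht hν]

theorem rnDeriv_toSignedMeasure_sub_smul [IsFiniteMeasure ν] (c : ℝ) :
    (μ.toSignedMeasure - c • ν.toSignedMeasure).rnDeriv ν =ᵐ[ν]
      fun x => (μ.rnDeriv ν x).toReal - c := by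
  have hρ : Integrable (fun x => (μ.rnDeriv ν x).toReal) ν := Measure.integrable_toReal_rnDeriv
  have hρc : Integrable (fun x => (μ.rnDeriv ν x).toReal - c) ν := hρ.sub (integrable_const c)
  refine (SignedMeasure.eq_rnDeriv _ _ hρc
    (toSignedMeasure_singularPart_mutuallySingular μ ν) ?_).symm
  ext s hs
  have hμs : μ.real s = (μ.singularPart ν).real s + (ν.withDensity (μ.rnDeriv ν)).real s := by
    rw [← measureReal_add_apply, Measure.singularPart_add_rnDeriv]
  rw [sub_apply, smul_apply, add_apply, Measure.toSignedMeasure_apply_measurable hs,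
    Measure.toSignedMeasure_apply_measurable hs, Measure.toSignedMeasure_apply_measurable hs,
    withDensityᵥ_apply hρc hs, integral_sub hρ.integrableOn (integrable_const c).integrableOn,
    setIntegral_const, Measure.setIntegral_toReal_rnDeriv_eq_withDensity' hs, hμs, smul_eq_mul,
    smul_eq_mul, mul_comm c, add_sub_assoc]

end RadonNikodym

end MeasureDuality

namespace ThinFilm

open Filter Topology MeasureDuality

section PhiDuality

theorem measurable_Phi : Measurable Phi :=
  Measurable.ite measurableSet_Iic measurable_const (by fun_prop)

theorem ofReal_le_Phi {b : ℝ} (hb : 0 ≤ b) (x : ℝ) :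
    ENNReal.ofReal (3 / 2 * b ^ 2 - b ^ 3 * x) ≤ Phi x := by
  unfold Phi
  split_ifs with hx
  · exact le_top
  · push Not at hx
    refine ENNReal.ofReal_le_ofReal ?_
    rw [inv_eq_one_div, div_div, le_div_iff₀ (by positivity)]
    -- with `y = b * x`, this is `(1 - y)² * (1 + 2 * y) ≥ 0`
    nlinarith [mul_nonneg (sq_nonneg (1 - b * x)) (by positivity : 0 ≤ 1 + 2 * (b * x))]

theorem tendsto_ofReal_inv_sq_Phi {x : ℝ} (hx : 0 ≤ x) :
    Tendsto (fun n : ℕ => ENNReal.ofReal ((x + 1 / ((n : ℝ) + 1))⁻¹ ^ 2 / 2)) atTop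
      (𝓝 (Phi x)) := by
  unfold Phi
  split_ifs with hx0
  · obtain rfl : x = 0 := le_antisymm hx0 hx
    simp only [zero_add, one_div, inv_inv]
    exact ENNReal.tendsto_ofReal_atTop.comp <| ((tendsto_pow_atTop two_ne_zero).comp
      (tendsto_atTop_add_const_right _ _ tendsto_natCast_atTop_atTop)).atTop_div_const two_pos
  · have hlim : Tendsto (fun n : ℕ => x + 1 / ((n : ℝ) + 1)) atTop (𝓝 (x + 0)) :=
      tendsto_const_nhds.add tendsto_one_div_add_atTop_nhds_zero_nat
    rw [add_zero] at hlim
    refine (ENNReal.continuous_ofReal.tendsto _).comp ?_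
    rw [← inv_pow]
    exact ((hlim.inv₀ (not_le.1 hx0).ne').pow 2).div_const 2

variable {X : Type*} [MeasurableSpace X]

/-- The functional whose supremum over the continuous `g ≥ 0` is `∫ Φ(dμ/dν) dν`, because
`Φ(x) = sup_{b ≥ 0} (3/2 b² - b³ x)`; for `x > 0` the supremum is attained at `b = 1/x`. -/
noncomputable def dualEnergy (μ ν : Measure X) (g : X → ℝ) : ℝ :=
  (∫ x, 3 / 2 * g x ^ 2 ∂ν) - ∫ x, g x ^ 3 ∂μ

variable {μ ν : Measure X} {g : X → ℝ} {A K : ℝ}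

theorem integrable_pow_of_mem_Icc [IsFiniteMeasure μ] (hg : Measurable g)
    (hgA : ∀ x, g x ∈ Icc 0 A) (k : ℕ) : Integrable (fun x => g x ^ k) μ := by
  refine Integrable.of_bound (hg.pow_const k).aestronglyMeasurable (A ^ k)
    (Eventually.of_forall fun x => ?_)
  rw [Real.norm_of_nonneg (pow_nonneg (hgA x).1 k)]
  exact pow_le_pow_left₀ (hgA x).1 (hgA x).2 k

theorem integrable_pow_mul_toReal_rnDeriv [IsFiniteMeasure μ] (hg : Measurable g)
    (hgA : ∀ x, g x ∈ Icc 0 A) (k : ℕ) :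
    Integrable (fun x => g x ^ k * (μ.rnDeriv ν x).toReal) ν := by
  refine Measure.integrable_toReal_rnDeriv.bdd_mul (hg.pow_const k).aestronglyMeasurable
    (c := A ^ k) (Eventually.of_forall fun x => ?_)
  rw [Real.norm_of_nonneg (pow_nonneg (hgA x).1 k)]
  exact pow_le_pow_left₀ (hgA x).1 (hgA x).2 k

theorem dualEnergy_withDensity_rnDeriv [IsFiniteMeasure μ] [IsFiniteMeasure ν] (hg : Measurable g)
    (hgA : ∀ x, g x ∈ Icc 0 A) :
    dualEnergy (ν.withDensity (μ.rnDeriv ν)) ν g =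
      ∫ x, (3 / 2 * g x ^ 2 - g x ^ 3 * (μ.rnDeriv ν x).toReal) ∂ν := by
  rw [dualEnergy, integral_withDensity_eq_integral_toReal_smul (Measure.measurable_rnDeriv _ _)
    (Measure.rnDeriv_lt_top μ ν), integral_sub ((integrable_pow_of_mem_Icc hg hgA 2).const_mul _)
    (integrable_pow_mul_toReal_rnDeriv hg hgA 3)]
  simp only [smul_eq_mul, mul_comm]

theorem dualEnergy_le_withDensity_rnDeriv [IsFiniteMeasure μ] (hg : Measurable g)
    (hgA : ∀ x, g x ∈ Icc 0 A) :
    dualEnergy μ ν g ≤ dualEnergy (ν.withDensity (μ.rnDeriv ν)) ν g :=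
  sub_le_sub_left (integral_mono_measure (Measure.withDensity_rnDeriv_le μ ν)
    (Eventually.of_forall fun x => pow_nonneg (hgA x).1 3) (integrable_pow_of_mem_Icc hg hgA 3)) _

theorem dualEnergy_le_of_lintegral_Phi_le [IsFiniteMeasure μ] [IsFiniteMeasure ν]
    (hK : 0 ≤ K) (h : ∫⁻ x, Phi (μ.rnDeriv ν x).toReal ∂ν ≤ ENNReal.ofReal K)
    (hg : Measurable g) (hgA : ∀ x, g x ∈ Icc 0 A) : dualEnergy μ ν g ≤ K := by
  have hint : Integrable (fun x => 3 / 2 * g x ^ 2 - g x ^ 3 * (μ.rnDeriv ν x).toReal) ν :=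
    ((integrable_pow_of_mem_Icc hg hgA 2).const_mul _).sub
      (integrable_pow_mul_toReal_rnDeriv hg hgA 3)
  refine (dualEnergy_le_withDensity_rnDeriv hg hgA).trans ?_
  rw [dualEnergy_withDensity_rnDeriv hg hgA,
    integral_eq_lintegral_pos_part_sub_lintegral_neg_part hint]
  refine (sub_le_self _ ENNReal.toReal_nonneg).trans (ENNReal.toReal_le_of_le_ofReal hK ?_)
  exact (lintegral_mono fun x => ofReal_le_Phi (hgA x).1 _).trans h

/-- Multiplying `b` by the indicator of a `ν`-full set that is null for the singular part of `μ`
removes that singular part from the dual energy. -/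
theorem exists_dualEnergy_eq_withDensity_rnDeriv [IsFiniteMeasure μ] [SigmaFinite ν]
    {b : X → ℝ} (hb : Measurable b) (hbA : ∀ x, b x ∈ Icc 0 A) :
    ∃ g : X → ℝ, Measurable g ∧ (∀ x, g x ∈ Icc 0 A) ∧
      dualEnergy μ ν g = dualEnergy (ν.withDensity (μ.rnDeriv ν)) ν b := by
  classical
  obtain ⟨S, hS, hsing, hν⟩ := μ.mutuallySingular_singularPart ν
  have hgA (x : X) : S.indicator b x ∈ Icc 0 A := by
    rw [indicator_apply]
    split_ifs
    exacts [hbA x, left_mem_Icc.2 ((hbA x).1.trans (hbA x).2)]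
  have hgν : S.indicator b =ᵐ[ν] b := by
    filter_upwards [measure_eq_zero_iff_ae_notMem.1 hν] with x hx
    exact indicator_of_mem (not_not.1 hx) _
  have hgsing : (fun x => S.indicator b x ^ 3) =ᵐ[μ.singularPart ν] 0 := by
    filter_upwards [measure_eq_zero_iff_ae_notMem.1 hsing] with x hx
    rw [indicator_of_notMem hx, zero_pow three_ne_zero, Pi.zero_apply]
  have hsplit : ∫ x, S.indicator b x ^ 3 ∂μ =
      ∫ x, S.indicator b x ^ 3 ∂(ν.withDensity (μ.rnDeriv ν)) := by
    have hint (m : Measure X) [IsFiniteMeasure m] : Integrable (fun x => S.indicator b x ^ 3) m :=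
      integrable_pow_of_mem_Icc (hb.indicator hS) hgA 3
    conv_lhs => rw [← Measure.singularPart_add_rnDeriv μ ν]
    rw [integral_add_measure (hint _) (hint _), integral_eq_zero_of_ae hgsing, zero_add]
  refine ⟨S.indicator b, hb.indicator hS, hgA, ?_⟩
  rw [dualEnergy, hsplit, dualEnergy]
  congr 1
  · exact integral_congr_ae (hgν.mono fun x hx => congrArg (3 / 2 * · ^ 2) hx)
  · exact integral_congr_ae ((withDensity_absolutelyContinuous _ _).ae_le
      (hgν.mono fun x hx => congrArg (· ^ 3) hx))

theorem lintegral_sq_le_of_dualEnergy_le [IsFiniteMeasure μ] [IsFiniteMeasure ν]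
    (h : ∀ g : X → ℝ, Measurable g → (∀ x, g x ∈ Icc 0 A) → dualEnergy μ ν g ≤ K) {b : X → ℝ}
    (hb : Measurable b) (hbA : ∀ x, b x ∈ Icc 0 A) (hbρ : ∀ x, b x * (μ.rnDeriv ν x).toReal ≤ 1) :
    ∫⁻ x, ENNReal.ofReal (b x ^ 2 / 2) ∂ν ≤ ENNReal.ofReal K := by
  obtain ⟨g, hg, hgA, hgb⟩ := exists_dualEnergy_eq_withDensity_rnDeriv (μ := μ) (ν := ν) hb hbA
  have hb2 := integrable_pow_of_mem_Icc (μ := ν) hb hbA 2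
  rw [← ofReal_integral_eq_lintegral_ofReal (hb2.div_const 2)
    (Eventually.of_forall fun x => by positivity)]
  refine ENNReal.ofReal_le_ofReal (le_trans ?_ (h g hg hgA))
  rw [hgb, dualEnergy_withDensity_rnDeriv hb hbA]
  refine integral_mono (hb2.div_const 2)
    ((hb2.const_mul _).sub (integrable_pow_mul_toReal_rnDeriv hb hbA 3)) fun x => ?_
  dsimp only
  linarith [mul_le_mul_of_nonneg_left (hbρ x) (sq_nonneg (b x))]

theorem lintegral_Phi_le_of_dualEnergy_le [IsFiniteMeasure μ] [IsFiniteMeasure ν]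
    (h : ∀ g : X → ℝ, Measurable g → ∀ A, (∀ x, g x ∈ Icc 0 A) → dualEnergy μ ν g ≤ K) :
    ∫⁻ x, Phi (μ.rnDeriv ν x).toReal ∂ν ≤ ENNReal.ofReal K := by
  set ρ : X → ℝ := fun x => (μ.rnDeriv ν x).toReal
  have hρ (x : X) : 0 ≤ ρ x := ENNReal.toReal_nonneg
  -- the optimal `b = 1 / ρ`, regularised so as to be bounded
  set b : ℕ → X → ℝ := fun n x => (ρ x + 1 / ((n : ℝ) + 1))⁻¹
  have hpos (n : ℕ) (x : X) : 0 < ρ x + 1 / ((n : ℝ) + 1) :=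
    add_pos_of_nonneg_of_pos (hρ x) (by positivity)
  have hb (n : ℕ) : Measurable (b n) :=
    ((Measure.measurable_rnDeriv μ ν).ennreal_toReal.add_const _).inv
  have hbn (n : ℕ) (x : X) : b n x ∈ Icc 0 ((n : ℝ) + 1) := by
    refine ⟨inv_nonneg.2 (hpos n x).le, inv_le_of_inv_le₀ (by positivity) ?_⟩
    rw [← one_div]
    exact le_add_of_nonneg_left (hρ x)
  have hbρ (n : ℕ) (x : X) : b n x * ρ x ≤ 1 := by
    rw [inv_mul_le_iff₀ (hpos n x), mul_one]
    exact le_add_of_nonneg_right (by positivity)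
  calc ∫⁻ x, Phi (ρ x) ∂ν
      = ∫⁻ x, liminf (fun n => ENNReal.ofReal (b n x ^ 2 / 2)) atTop ∂ν :=
        lintegral_congr fun x => (tendsto_ofReal_inv_sq_Phi (hρ x)).liminf_eq.symm
    _ ≤ liminf (fun n => ∫⁻ x, ENNReal.ofReal (b n x ^ 2 / 2) ∂ν) atTop :=
        lintegral_liminf_le fun n => (((hb n).pow_const 2).div_const 2).ennreal_ofReal
    _ ≤ ENNReal.ofReal K := liminf_le_of_frequently_le' <| Frequently.of_forall fun n =>
        lintegral_sq_le_of_dualEnergy_le (fun g hg => h g hg _) (hb n) (hbn n) (hbρ n)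

variable [TopologicalSpace X] [TopologicalSpace.PseudoMetrizableSpace X] [BorelSpace X]

theorem dualEnergy_le_of_forall_continuous [IsFiniteMeasure μ] [IsFiniteMeasure ν]
    (h : ∀ f : X → ℝ, Continuous f → (∀ x, 0 ≤ f x) → dualEnergy μ ν f ≤ K)
    (hg : Measurable g) (hA : 0 ≤ A) (hgA : ∀ x, g x ∈ Icc 0 A) : dualEnergy μ ν g ≤ K := by
  obtain ⟨f, hf, hfA, hlim⟩ := exists_seq_continuous_tendsto_ae (ν + μ) hg hA hgA
  rw [ae_add_measure_iff] at hlim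
  have hpow (k n : ℕ) (x : X) : |f n x ^ k| ≤ A ^ k := by
    rw [abs_of_nonneg (pow_nonneg (hfA n x).1 k)]
    exact pow_le_pow_left₀ (hfA n x).1 (hfA n x).2 k
  have hlim2 := (tendsto_integral_of_continuous_of_bounded (fun n => (hf n).pow 2) (hpow 2)
    (hlim.1.mono fun x hx => hx.pow 2)).const_mul (3 / 2)
  have hlim3 := tendsto_integral_of_continuous_of_bounded (fun n => (hf n).pow 3) (hpow 3)
    (hlim.2.mono fun x hx => hx.pow 3)
  simp only [← integral_const_mul] at hlim2
  exact le_of_tendsto' (hlim2.sub hlim3) fun n => h (f n) (hf n) fun x => (hfA n x).1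

theorem lintegral_Phi_le_iff [CompactSpace X] [IsFiniteMeasure μ] [IsFiniteMeasure ν]
    (hK : 0 ≤ K) :
    ∫⁻ x, Phi (μ.rnDeriv ν x).toReal ∂ν ≤ ENNReal.ofReal K ↔
      ∀ f : X → ℝ, Continuous f → (∀ x, 0 ≤ f x) → dualEnergy μ ν f ≤ K := by
  refine ⟨fun h f hf hf0 => ?_, fun h => lintegral_Phi_le_of_dualEnergy_le fun g hg A hgA => ?_⟩
  · obtain ⟨A, hA⟩ := isCompact_univ.exists_bound_of_continuousOn hf.continuousOn
    exact dualEnergy_le_of_lintegral_Phi_le hK h hf.measurable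
      fun x => ⟨hf0 x, (le_abs_self _).trans (hA x (mem_univ x))⟩
  · obtain hX | ⟨⟨x⟩⟩ := isEmpty_or_nonempty X
    · exact h g (continuous_of_const fun x => hX.elim x) fun x => (hgA x).1
    · exact dualEnergy_le_of_forall_continuous h hg ((hgA x).1.trans (hgA x).2) hgA

end PhiDuality

end ThinFilm

namespace ThinFilm

open Filter Topology MeasureDuality

section SmoothFunctions

variable {f g : Torus → ℝ}

theorem torus_measureReal_univ : (volume : Measure Torus).real univ = 1 := by
  rw [measureReal_def, UnitAddCircle.measure_univ, ENNReal.toReal_one]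

theorem smoothOnTorus_const (c : ℝ) : SmoothOnTorus (fun _ => c) := contDiff_const

theorem SmoothOnTorus.sub (hf : SmoothOnTorus f) (hg : SmoothOnTorus g) :
    SmoothOnTorus (fun x => f x - g x) := ContDiff.sub hf hg

theorem SmoothOnTorus.differentiable (hf : SmoothOnTorus f) :
    Differentiable ℝ (fun s : ℝ => f (s : Torus)) := ContDiff.differentiable hf (by simp)

theorem SmoothOnTorus.dh_add (hf : SmoothOnTorus f) (hg : SmoothOnTorus g) :
    ThinFilm.dh (f + g) = ThinFilm.dh f + ThinFilm.dh g := by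
  funext x
  induction x using QuotientAddGroup.induction_on with | H t =>
  rw [Pi.add_apply, dh_coe, dh_coe, dh_coe]
  exact deriv_fun_add (hf.differentiable t) (hg.differentiable t)

theorem SmoothOnTorus.dh_const_smul (hf : SmoothOnTorus f) (c : ℝ) :
    ThinFilm.dh (c • f) = c • ThinFilm.dh f := by
  funext x
  induction x using QuotientAddGroup.induction_on with | H t =>
  rw [Pi.smul_apply, dh_coe, dh_coe]
  exact deriv_fun_const_smul c (hf.differentiable t)

theorem dh_sub_const (f : Torus → ℝ) (c : ℝ) : dh (fun x => f x - c) = dh f := by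
  funext x
  induction x using QuotientAddGroup.induction_on with | H t =>
  rw [dh_coe, dh_coe]
  exact deriv_sub_const c

/-- The smooth functions, as a subalgebra of `C(𝕋)`. -/
noncomputable def smoothFunctions : Subalgebra ℝ C(Torus, ℝ) where
  carrier := {f | SmoothOnTorus f}
  mul_mem' := fun {_ _} (ha : SmoothOnTorus _) (hb : SmoothOnTorus _) => ContDiff.mul ha hb
  add_mem' := fun {_ _} (ha : SmoothOnTorus _) (hb : SmoothOnTorus _) => ContDiff.add ha hb
  algebraMap_mem' := smoothOnTorus_const

/-- A smooth function on the torus, as an element of `smoothFunctions`. -/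
def SmoothOnTorus.toSmoothFunctions (hf : SmoothOnTorus f) : smoothFunctions :=
  ⟨⟨f, hf.continuous⟩, hf⟩

/-- Differentiation of smooth functions. -/
noncomputable def smoothDeriv : smoothFunctions →ₗ[ℝ] smoothFunctions where
  toFun f := (SmoothOnTorus.dh f.2).toSmoothFunctions
  map_add' f g := Subtype.ext (ContinuousMap.ext (congrFun (SmoothOnTorus.dh_add f.2 g.2)))
  map_smul' c f := Subtype.ext (ContinuousMap.ext (congrFun (SmoothOnTorus.dh_const_smul f.2 c)))

theorem separatesPoints_smoothFunctions : smoothFunctions.SeparatesPoints := by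
  intro x y hxy
  have hinj : (fourier 1 : C(Torus, ℂ)) x ≠ fourier 1 y := by
    simp only [fourier_one]
    exact fun h => hxy (AddCircle.injective_toCircle one_ne_zero (Subtype.ext h))
  have hsmooth : ContDiff ℝ ∞ (fun s : ℝ => (fourier 1 : C(Torus, ℂ)) (s : Torus)) := by
    simp only [fourier_coe_apply]
    exact ((contDiff_const.mul Complex.ofRealCLM.contDiff).div_const _).cexp
  have hre : SmoothOnTorus (fun z => ((fourier 1 : C(Torus, ℂ)) z).re) :=
    Complex.reCLM.contDiff.comp hsmooth
  have him : SmoothOnTorus (fun z => ((fourier 1 : C(Torus, ℂ)) z).im) :=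
    Complex.imCLM.contDiff.comp hsmooth
  by_cases h : ((fourier 1 : C(Torus, ℂ)) x).re = ((fourier 1 : C(Torus, ℂ)) y).re
  · refine ⟨_, ⟨⟨_, him.continuous⟩, him, rfl⟩, fun h' => hinj (Complex.ext h h')⟩
  · exact ⟨_, ⟨⟨_, hre.continuous⟩, hre, rfl⟩, h⟩

theorem dense_smoothFunctions : Dense (smoothFunctions : Set C(Torus, ℝ)) := by
  rw [dense_iff_closure_eq, ← Subalgebra.topologicalClosure_coe,
    ContinuousMap.subalgebra_topologicalClosure_eq_top_of_separatesPoints _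
      separatesPoints_smoothFunctions, Algebra.coe_top]

theorem signedMeasure_ext_of_smooth {σ τ : SignedMeasure Torus}
    (h : ∀ f : Torus → ℝ, SmoothOnTorus f → ∫ᵛ x, f x ∂<•σ = ∫ᵛ x, f x ∂<•τ) : σ = τ :=
  signedMeasure_ext_of_continuous <| congrFun <|
    (continuous_integral_signedMeasure σ).ext_on dense_smoothFunctions
      (continuous_integral_signedMeasure τ) fun f hf => h f hf

end SmoothFunctions

section DenseInL2

/-- The inclusion of the smooth functions in `L²(𝕋)`. -/
noncomputable def smoothToL2 : smoothFunctions →ₗ[ℝ] L2Torus :=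
  (ContinuousMap.toLp 2 (volume : Measure Torus) ℝ : C(Torus, ℝ) →L[ℝ] L2Torus).toLinearMap ∘ₗ
    smoothFunctions.val.toLinearMap

theorem coeFn_smoothToL2 (f : smoothFunctions) :
    (smoothToL2 f : L2Torus) =ᵐ[volume] (f : C(Torus, ℝ)) :=
  ContinuousMap.coeFn_toLp volume (f : C(Torus, ℝ))

theorem denseRange_smoothToL2 : DenseRange smoothToL2 :=
  (ContinuousMap.toLp_denseRange ℝ (volume : Measure Torus) ℝ (by norm_num)).comp
    dense_smoothFunctions.denseRange_val (ContinuousLinearMap.continuous _)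

theorem inner_smoothToL2 (u : L2Torus) (f : smoothFunctions) :
    inner ℝ u (smoothToL2 f) = ∫ x, u x * (f : C(Torus, ℝ)) x := by
  rw [L2.inner_def]
  refine integral_congr_ae ?_
  filter_upwards [coeFn_smoothToL2 f] with x hx
  rw [hx, real_inner_eq_re_inner, mul_comm]
  rfl

theorem integral_abs_le_norm_smoothToL2 (f : smoothFunctions) :
    ∫ x, |(f : C(Torus, ℝ)) x| ≤ ‖smoothToL2 f‖ := by
  have hprob : IsProbabilityMeasure (volume : Measure Torus) := ⟨UnitAddCircle.measure_univ⟩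
  have hf : AEStronglyMeasurable (f : C(Torus, ℝ)) (volume : Measure Torus) :=
    (f : C(Torus, ℝ)).continuous.aestronglyMeasurable
  calc ∫ x, |(f : C(Torus, ℝ)) x| = (eLpNorm (f : C(Torus, ℝ)) 1 volume).toReal := by
        rw [eLpNorm_one_eq_lintegral_enorm]
        exact integral_norm_eq_lintegral_enorm hf
    _ ≤ (eLpNorm (f : C(Torus, ℝ)) 2 volume).toReal :=
        ENNReal.toReal_mono (SmoothOnTorus.memLp f.2).eLpNorm_ne_top
          (eLpNorm_le_eLpNorm_of_exponent_le (by norm_num) hf)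
    _ = ‖smoothToL2 f‖ := by rw [Lp.norm_def, eLpNorm_congr_ae (coeFn_smoothToL2 f)]

theorem exists_eq_inner_smoothToL2 (ℓ : smoothFunctions →ₗ[ℝ] ℝ)
    (hℓ : ∃ K, ∀ f, ‖ℓ f‖ ≤ K * ‖smoothToL2 f‖) :
    ∃ u : L2Torus, ∀ f, ℓ f = inner ℝ u (smoothToL2 f) := by
  refine ⟨(InnerProductSpace.toDual ℝ L2Torus).symm (ℓ.extendOfNorm smoothToL2), fun f => ?_⟩
  rw [InnerProductSpace.toDual_symm_apply, LinearMap.extendOfNorm_eq denseRange_smoothToL2 hℓ]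

theorem norm_le_of_abs_inner_smoothToL2_le {u : L2Torus} {K : ℝ} (hK : 0 ≤ K)
    (h : ∀ f, |inner ℝ u (smoothToL2 f)| ≤ K * ‖smoothToL2 f‖) : ‖u‖ ≤ K := by
  rw [← innerSL_apply_norm ℝ u]
  exact ContinuousLinearMap.opNorm_le_bound _ hK fun v =>
    denseRange_smoothToL2.induction_on v (isClosed_le (by fun_prop) (by fun_prop)) h

end DenseInL2

section Primitives

variable {f : Torus → ℝ}

theorem SmoothOnTorus.integrable (hf : SmoothOnTorus f) :
    Integrable f (volume : Measure Torus) :=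
  integrable_of_continuous hf.continuous _

theorem exists_dh_eq_of_integral_eq_zero (hf : SmoothOnTorus f) (hmean : ∫ x, f x = 0) :
    ∃ F : Torus → ℝ, SmoothOnTorus F ∧ dh F = f ∧ ∀ x, |F x| ≤ ∫ y, |f y| := by
  set G : ℝ → ℝ := fun t => ∫ s in (0 : ℝ)..t, f (s : Torus)
  have hcont : Continuous fun s : ℝ => f (s : Torus) := ContDiff.continuous hf
  have hderiv (t : ℝ) : HasDerivAt G (f (t : Torus)) t :=
    (hcont.integral_hasStrictDerivAt 0 t).hasDerivAt
  have hper : Function.Periodic G 1 := fun t => by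
    rw [← sub_eq_zero, intervalIntegral.integral_interval_sub_left
      (hcont.intervalIntegrable _ _) (hcont.intervalIntegrable _ _),
      UnitAddCircle.intervalIntegral_preimage t f, hmean]
  have hlift : (fun s : ℝ => (hper.lift : Torus → ℝ) (s : Torus)) = G := funext hper.lift_coe
  refine ⟨hper.lift, ?_, ?_, fun x => ?_⟩
  · rw [SmoothOnTorus, hlift, contDiff_infty_iff_deriv]
    exact ⟨fun t => (hderiv t).differentiableAt, by rwa [funext fun t => (hderiv t).deriv]⟩
  · funext x
    induction x using QuotientAddGroup.induction_on with | H t =>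
    rw [dh_coe, hlift]
    exact (hderiv t).deriv
  · obtain ⟨t, ht, rfl⟩ : ∃ t ∈ Ico (0 : ℝ) (0 + 1), (t : Torus) = x := by
      have hx : x ∈ ((↑) : ℝ → Torus) '' Ico 0 (0 + 1) := by
        rw [AddCircle.coe_image_Ico_eq]
        exact mem_univ x
      exact hx
    rw [zero_add] at ht
    rw [congrFun hlift t, ← UnitAddCircle.intervalIntegral_preimage 0 (fun y => |f y|), zero_add]
    exact (intervalIntegral.abs_integral_le_integral_abs ht.1).trans
      (intervalIntegral.integral_mono_interval le_rfl ht.1 ht.2.le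
        (Eventually.of_forall fun _ => abs_nonneg _) (hcont.abs.intervalIntegrable 0 1))

theorem exists_dh_eq_sub_integral (hf : SmoothOnTorus f) :
    ∃ F : Torus → ℝ, SmoothOnTorus F ∧ (dh F = fun x => f x - ∫ y, f y) ∧
      ∀ x, |F x| ≤ 2 * ∫ y, |f y| := by
  have hsub := hf.sub (smoothOnTorus_const (∫ y, f y))
  obtain ⟨F, hF, hdF, hbound⟩ := exists_dh_eq_of_integral_eq_zero hsub (by
    rw [integral_sub hf.integrable (integrable_const _), integral_const,
      torus_measureReal_univ, one_smul, sub_self])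
  refine ⟨F, hF, hdF, fun x => (hbound x).trans ?_⟩
  calc ∫ y, |f y - ∫ z, f z| ≤ ∫ y, (|f y| + |∫ z, f z|) :=
        integral_mono hsub.integrable.abs (hf.integrable.abs.add (integrable_const _))
          fun y => abs_sub _ _
    _ = (∫ y, |f y|) + |∫ z, f z| := by
        rw [integral_add hf.integrable.abs (integrable_const _), integral_const,
          torus_measureReal_univ, one_smul]
    _ ≤ 2 * ∫ y, |f y| := by linarith [abs_integral_le_integral_abs (f := f) (μ := volume)]

theorem exists_dh_dh_eq_sub_integral (hf : SmoothOnTorus f) :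
    ∃ G : Torus → ℝ, SmoothOnTorus G ∧ (dh (dh G) = fun x => f x - ∫ y, f y) ∧
      ∀ x, |G x| ≤ 4 * ∫ y, |f y| := by
  obtain ⟨F, hF, hdF, hFf⟩ := exists_dh_eq_sub_integral hf
  obtain ⟨G, hG, hdG, hGF⟩ := exists_dh_eq_sub_integral hF
  have hF1 : ∫ y, |F y| ≤ 2 * ∫ y, |f y| := by
    refine (integral_mono hF.integrable.abs (integrable_const _) hFf).trans_eq ?_
    rw [integral_const, torus_measureReal_univ, one_smul]
  refine ⟨G, hG, ?_, fun x => (hGF x).trans (by linarith)⟩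
  rw [hdG, dh_sub_const, hdF]

end Primitives

section SecondDerivative

theorem IsSecondDeriv.unique {u : L2Torus} {σ τ : SignedMeasure Torus} (hσ : IsSecondDeriv u σ)
    (hτ : IsSecondDeriv u τ) : σ = τ :=
  signedMeasure_ext_of_smooth fun f hf => (hσ f hf).symm.trans (hτ f hf)

theorem hh_eq {u : USpace} {σ : SignedMeasure Torus} (h : IsSecondDeriv (u : L2Torus) σ) :
    hh u = σ := by
  have hex : ∃ μ, IsSecondDeriv (u : L2Torus) μ := ⟨σ, h⟩
  rw [hh, dif_pos hex]
  exact hex.choose_spec.unique h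

theorem IsSecondDeriv.memW12 {u : L2Torus} {σ : SignedMeasure Torus} (h : IsSecondDeriv u σ) :
    MemW12 u := by
  let ℓ : smoothFunctions →ₗ[ℝ] ℝ := (innerSL ℝ u).toLinearMap ∘ₗ smoothToL2 ∘ₗ smoothDeriv
  have hℓ (f : smoothFunctions) : ℓ f = ∫ x, u x * dh (f : C(Torus, ℝ)) x :=
    inner_smoothToL2 u (smoothDeriv f)
  have hbound (f : smoothFunctions) :
      ‖(-ℓ) f‖ ≤ 2 * σ.totalVariation.real univ * ‖smoothToL2 f‖ := by
    obtain ⟨F, hF, hdF, hFf⟩ := exists_dh_eq_sub_integral f.2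
    have hℓF : ℓ f = ∫ᵛ x, F x ∂<•σ := by
      rw [hℓ, ← h F hF, hdF, dh_sub_const]
    rw [LinearMap.neg_apply, norm_neg, hℓF, mul_right_comm]
    exact abs_integral_signedMeasure_le (fun x => (hFf x).trans
      (mul_le_mul_of_nonneg_left (integral_abs_le_norm_smoothToL2 f) zero_le_two)) σ
  obtain ⟨u', hu'⟩ := exists_eq_inner_smoothToL2 (-ℓ) ⟨_, hbound⟩
  refine ⟨u', fun f hf => ?_⟩
  have hrepr := hu' hf.toSmoothFunctions
  rw [LinearMap.neg_apply, hℓ, inner_smoothToL2] at hrepr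
  exact neg_eq_iff_eq_neg.1 hrepr

theorem mem_VTilde_of_isSecondDeriv {u : USpace} {σ : SignedMeasure Torus}
    (h : IsSecondDeriv (u : L2Torus) σ) : u ∈ VTilde := ⟨h.memW12, σ, h⟩

theorem norm_le_four_mul_normV {v : USpace} (hv : v ∈ VTilde) : ‖v‖ ≤ 4 * normV v := by
  have hnonneg : 0 ≤ 4 * normV v := mul_nonneg zero_le_four measureReal_nonneg
  refine norm_le_of_abs_inner_smoothToL2_le (u := (v : L2Torus)) hnonneg fun f => ?_
  obtain ⟨G, hG, hddG, hbound⟩ := exists_dh_dh_eq_sub_integral f.2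
  have hinner : inner ℝ (v : L2Torus) (smoothToL2 f) = ∫ᵛ x, G x ∂<•(hh v) := by
    have hmean : ∫ x, (v : L2Torus) x = 0 := v.2
    rw [← hh_spec hv G hG, hddG, inner_smoothToL2]
    simp only [mul_sub]
    rw [integral_sub (SmoothOnTorus.integrable_mul f.2 _)
      ((smoothOnTorus_const _).integrable_mul _), integral_mul_const, hmean, zero_mul, sub_zero]
  rw [hinner, mul_right_comm]
  exact abs_integral_signedMeasure_le (fun x => (hbound x).trans
    (mul_le_mul_of_nonneg_left (integral_abs_le_norm_smoothToL2 f) zero_le_four)) _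

end SecondDerivative

end ThinFilm

namespace ThinFilm

open Filter Topology MeasureDuality ConvexFlow
open scoped NNReal

section Shift

/-- `μ` is the measure `u_hh + c₀`, for `u ∈ U`. -/
def IsShiftedSecondDeriv (c₀ : ℝ) (u : USpace) (μ : FiniteMeasure Torus) : Prop :=
  ∀ f : Torus → ℝ, SmoothOnTorus f →
    ∫ x, (u : L2Torus) x * dh (dh f) x = ∫ x, f x ∂(μ : Measure Torus) - c₀ * ∫ x, f x

theorem integral_toSignedMeasure_sub_smul_volume {f : Torus → ℝ} (hf : Continuous f) (c₀ : ℝ)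
    (μ : FiniteMeasure Torus) :
    ∫ᵛ x, f x ∂<•((μ : Measure Torus).toSignedMeasure -
        c₀ • (volume : Measure Torus).toSignedMeasure) =
      ∫ x, f x ∂(μ : Measure Torus) - c₀ * ∫ x, f x := by
  rw [VectorMeasure.integral_sub_vectorMeasure (integrable_signedMeasure_of_continuous hf _)
    (integrable_signedMeasure_of_continuous hf _), VectorMeasure.integral_smul_vectorMeasure,
    VectorMeasure.integral_toSignedMeasure, VectorMeasure.integral_toSignedMeasure, smul_eq_mul]

theorem exists_isShiftedSecondDeriv {c₀ : ℝ} {u : USpace} (hu : u ∈ VTilde)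
    (hpos : PosMeasure c₀ u) : ∃ μ, IsShiftedSecondDeriv c₀ u μ := by
  have hpos' := (VectorMeasure.le_restrict_univ_iff_le _ _).2 hpos
  obtain ⟨m, hfin, hm⟩ : ∃ (m : Measure Torus) (_ : IsFiniteMeasure m),
      m.toSignedMeasure = hh u + c₀ • (volume : Measure Torus).toSignedMeasure :=
    ⟨_, SignedMeasure.toMeasureOfZeroLE_finite _ hpos' MeasurableSet.univ,
      SignedMeasure.toMeasureOfZeroLE_toSignedMeasure _ hpos'⟩
  let μ : FiniteMeasure Torus := ⟨m, hfin⟩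
  have hhh : hh u = (μ : Measure Torus).toSignedMeasure -
      c₀ • (volume : Measure Torus).toSignedMeasure := eq_sub_of_add_eq hm.symm
  refine ⟨μ, fun f hf => ?_⟩
  rw [hh_spec hu f hf, hhh, integral_toSignedMeasure_sub_smul_volume hf.continuous]

namespace IsShiftedSecondDeriv

variable {c₀ : ℝ} {u : USpace} {μ : FiniteMeasure Torus}

theorem isSecondDeriv (h : IsShiftedSecondDeriv c₀ u μ) :
    IsSecondDeriv (u : L2Torus) ((μ : Measure Torus).toSignedMeasure -
      c₀ • (volume : Measure Torus).toSignedMeasure) := fun f hf => by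
  rw [h f hf, integral_toSignedMeasure_sub_smul_volume hf.continuous]

theorem mem_VTilde (h : IsShiftedSecondDeriv c₀ u μ) : u ∈ VTilde :=
  mem_VTilde_of_isSecondDeriv h.isSecondDeriv

theorem hh_eq (h : IsShiftedSecondDeriv c₀ u μ) : hh u = (μ : Measure Torus).toSignedMeasure -
    c₀ • (volume : Measure Torus).toSignedMeasure := ThinFilm.hh_eq h.isSecondDeriv

theorem posMeasure (h : IsShiftedSecondDeriv c₀ u μ) : PosMeasure c₀ u := by
  rw [PosMeasure, h.hh_eq, sub_add_cancel]
  exact Measure.zero_le_toSignedMeasure _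

theorem integral_hh (h : IsShiftedSecondDeriv c₀ u μ) {f : Torus → ℝ} (hf : Continuous f) :
    ∫ᵛ x, f x ∂<•(hh u) = ∫ x, f x ∂(μ : Measure Torus) - c₀ * ∫ x, f x := by
  rw [h.hh_eq, integral_toSignedMeasure_sub_smul_volume hf]

theorem mass_eq (h : IsShiftedSecondDeriv c₀ u μ) : (μ.mass : ℝ) = c₀ := by
  have hdh (c : ℝ) : dh (fun _ : Torus => c) = fun _ => 0 := by
    funext x
    simp only [dh, deriv_const]
  have htest := h (fun _ => 1) (smoothOnTorus_const 1)
  rw [hdh, hdh, integral_const, integral_const, torus_measureReal_univ] at htest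
  simp only [mul_zero, integral_zero, smul_eq_mul, mul_one] at htest
  exact sub_eq_zero.1 htest.symm

theorem normV_le_iff (h : IsShiftedSecondDeriv c₀ u μ) {C : ℝ} :
    normV u ≤ C ↔ ∀ f : Torus → ℝ, Continuous f → (∀ x, |f x| ≤ 1) →
      ∫ x, f x ∂(μ : Measure Torus) - c₀ * ∫ x, f x ≤ C := by
  rw [normV, totalVariation_le_iff]
  refine forall₃_congr fun f hf _ => ?_
  rw [h.integral_hh hf]

theorem acDensity_add_ae_eq (h : IsShiftedSecondDeriv c₀ u μ) :
    (fun x => acDensity u x + c₀) =ᵐ[volume]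
      fun x => ((μ : Measure Torus).rnDeriv volume x).toReal := by
  filter_upwards [rnDeriv_toSignedMeasure_sub_smul (μ : Measure Torus) volume c₀] with x hx
  rw [acDensity, h.hh_eq, hx, sub_add_cancel]

theorem smul_add_smul {v : USpace} {ν : FiniteMeasure Torus} (hu : IsShiftedSecondDeriv c₀ u μ)
    (hv : IsShiftedSecondDeriv c₀ v ν) {a b : ℝ≥0} (hab : (a : ℝ) + b = 1) :
    IsShiftedSecondDeriv c₀ ((a : ℝ) • u + (b : ℝ) • v) (a • μ + b • ν) := fun f hf => by
  have hcoe : (((a : ℝ) • u + (b : ℝ) • v : USpace) : L2Torus) =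
    (a : ℝ) • (u : L2Torus) + (b : ℝ) • (v : L2Torus) := rfl
  rw [hcoe, integral_smul_add_smul_finiteMeasure hf.continuous, integral_lp_add_mul hf.dh.dh,
    integral_lp_smul_mul, integral_lp_smul_mul, hu f hf, hv f hf]
  linear_combination (-c₀ * ∫ x, f x) * hab

end IsShiftedSecondDeriv

theorem continuous_integral_mul_smooth {f : Torus → ℝ} (hf : SmoothOnTorus f) :
    Continuous fun u : USpace => ∫ x, (u : L2Torus) x * f x := by
  have hinner (u : USpace) : ∫ x, (u : L2Torus) x * f x =
      inner ℝ (u : L2Torus) (smoothToL2 hf.toSmoothFunctions) := by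
    rw [inner_smoothToL2]
    rfl
  simp only [hinner]
  fun_prop

theorem isClosed_isShiftedSecondDeriv (c₀ : ℝ) :
    IsClosed {p : USpace × FiniteMeasure Torus | IsShiftedSecondDeriv c₀ p.1 p.2} := by
  simp only [IsShiftedSecondDeriv, ofPred_forall]
  refine isClosed_iInter fun f => isClosed_iInter fun hf => isClosed_eq ?_ ?_
  · exact (continuous_integral_mul_smooth hf.dh.dh).comp continuous_fst
  · exact ((continuous_integral_finiteMeasure hf.continuous).comp continuous_snd).sub
      continuous_const

end Shift

section Energy

variable {c₀ C K : ℝ}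

/-- The functional `φ` on `U`, without the positivity constraint. -/
noncomputable def phiDensity (c₀ : ℝ) (w : USpace) : ℝ≥0∞ := ∫⁻ x, Phi (acDensity w x + c₀)

/-- The effective domain of `φ + ψ`. -/
def energyDomain (c₀ C : ℝ) : Set USpace :=
  {w | w ∈ VTilde ∧ PosMeasure c₀ w ∧ normV w ≤ C ∧ phiDensity c₀ w ≠ ⊤}

/-- The real-valued functional that agrees with `φ + ψ` on its effective domain. -/
noncomputable def energyReal (c₀ : ℝ) (w : USpace) : ℝ := (phiDensity c₀ w).toReal

theorem energyReal_nonneg (c₀ : ℝ) (u : USpace) : 0 ≤ energyReal c₀ u := ENNReal.toReal_nonneg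

theorem energy_eq_coe {w : VTilde} (hw : (w : USpace) ∈ energyDomain c₀ C) :
    energy c₀ C w = (energyReal c₀ w : EReal) := by
  rw [energy, phi, psi, if_pos hw.2.1, if_pos hw.2.2.1, add_zero, energyReal]
  exact (EReal.coe_ennreal_toReal hw.2.2.2).symm

theorem energy_eq_top {w : VTilde} (hw : (w : USpace) ∉ energyDomain c₀ C) :
    energy c₀ C w = ⊤ := by
  have htop : phi c₀ w + psi C w = ⊤ := by
    rw [phi, psi]
    split_ifs with hpos hnorm
    · rw [add_zero]
      by_contra hfin
      exact hw ⟨w.2, hpos, hnorm, hfin⟩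
    all_goals simp only [add_top, top_add]
  rw [energy, htop, EReal.coe_ennreal_top]

/-- The measures `μ` such that, if `μ = u_hh + c₀`, then `ψ(u) = 0` and `φ(u) ≤ K`; both
conditions are expressed by duality with continuous functions. -/
def dualSublevel (c₀ C K : ℝ) : Set (FiniteMeasure Torus) :=
  {μ | (∀ f : Torus → ℝ, Continuous f → (∀ x, |f x| ≤ 1) →
      ∫ x, f x ∂(μ : Measure Torus) - c₀ * ∫ x, f x ≤ C) ∧
    ∀ g : Torus → ℝ, Continuous g → (∀ x, 0 ≤ g x) → dualEnergy (μ : Measure Torus) volume g ≤ K}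

theorem isClosed_dualSublevel (c₀ C K : ℝ) : IsClosed (dualSublevel c₀ C K) := by
  simp only [dualSublevel, dualEnergy, ofPred_and, ofPred_forall]
  refine IsClosed.inter ?_ ?_ <;>
    refine isClosed_iInter fun f => isClosed_iInter fun hf => isClosed_iInter fun _ => ?_
  · exact isClosed_le ((continuous_integral_finiteMeasure hf).sub continuous_const)
      continuous_const
  · exact isClosed_le (continuous_const.sub (continuous_integral_finiteMeasure (hf.pow 3)))
      continuous_const

theorem smul_add_smul_mem_dualSublevel {L : ℝ} {μ ν : FiniteMeasure Torus}
    (hμ : μ ∈ dualSublevel c₀ C K) (hν : ν ∈ dualSublevel c₀ C L) {a b : ℝ≥0}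
    (hab : (a : ℝ) + b = 1) : a • μ + b • ν ∈ dualSublevel c₀ C (a * K + b * L) := by
  refine ⟨fun f hf hf1 => ?_, fun g hg hg0 => ?_⟩
  · rw [integral_smul_add_smul_finiteMeasure hf]
    linear_combination (a : ℝ) * hμ.1 f hf hf1 + (b : ℝ) * hν.1 f hf hf1 +
      (C + c₀ * ∫ x, f x) * hab
  · have hμg := hμ.2 g hg hg0
    have hνg := hν.2 g hg hg0
    rw [dualEnergy] at hμg hνg ⊢
    rw [integral_smul_add_smul_finiteMeasure (f := fun x => g x ^ 3) (hg.pow 3)]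
    linear_combination (a : ℝ) * hμg + (b : ℝ) * hνg - (∫ x, 3 / 2 * g x ^ 2) * hab

theorem phiDensity_le_iff {u : USpace} {μ : FiniteMeasure Torus}
    (h : IsShiftedSecondDeriv c₀ u μ) (hK : 0 ≤ K) :
    phiDensity c₀ u ≤ ENNReal.ofReal K ↔ ∀ g : Torus → ℝ, Continuous g → (∀ x, 0 ≤ g x) →
      dualEnergy (μ : Measure Torus) volume g ≤ K := by
  rw [← lintegral_Phi_le_iff hK, phiDensity,
    lintegral_congr_ae (h.acDensity_add_ae_eq.mono fun x hx => congrArg Phi hx)]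

theorem mem_sublevel_iff (hK : 0 ≤ K) {u : USpace} :
    u ∈ energyDomain c₀ C ∧ energyReal c₀ u ≤ K ↔
      ∃ μ ∈ dualSublevel c₀ C K, IsShiftedSecondDeriv c₀ u μ := by
  constructor
  · rintro ⟨⟨hV, hpos, hnorm, hfin⟩, hle⟩
    obtain ⟨μ, hμ⟩ := exists_isShiftedSecondDeriv hV hpos
    exact ⟨μ, ⟨hμ.normV_le_iff.1 hnorm, (phiDensity_le_iff hμ hK).1
      ((ENNReal.le_ofReal_iff_toReal_le hfin hK).2 hle)⟩, hμ⟩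
  · rintro ⟨μ, ⟨hnorm, hdual⟩, hμ⟩
    have hle := (phiDensity_le_iff hμ hK).2 hdual
    have hfin : phiDensity c₀ u ≠ ⊤ := ne_top_of_le_ne_top ENNReal.ofReal_ne_top hle
    exact ⟨⟨hμ.mem_VTilde, hμ.posMeasure, hμ.normV_le_iff.2 hnorm, hfin⟩,
      (ENNReal.le_ofReal_iff_toReal_le hfin hK).1 hle⟩

theorem exists_mem_dualSublevel {u : USpace} (hu : u ∈ energyDomain c₀ C) :
    ∃ μ ∈ dualSublevel c₀ C (energyReal c₀ u), IsShiftedSecondDeriv c₀ u μ :=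
  (mem_sublevel_iff (energyReal_nonneg c₀ u)).1 ⟨hu, le_rfl⟩

/-- The measures `u_hh + c₀` have mass `c₀`, so they range over a compact set, and the sublevel
set is the projection, along this compact set, of a closed set of pairs. -/
theorem isClosed_sublevel (hc₀ : 0 ≤ c₀) (C K : ℝ) :
    IsClosed {u | u ∈ energyDomain c₀ C ∧ energyReal c₀ u ≤ K} := by
  rcases lt_or_ge K 0 with hK | hK
  · convert isClosed_empty
    exact eq_empty_of_forall_notMem fun u hu =>
      (hK.trans_le (energyReal_nonneg c₀ u)).not_ge hu.2
  let S : Set (FiniteMeasure Torus) := {μ | μ.mass = ⟨c₀, hc₀⟩}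
  have hS : CompactSpace S := isCompact_iff_compactSpace.1
    (isCompact_setOfPred_finiteMeasure_eq_of_compactSpace Torus ⟨c₀, hc₀⟩)
  let Z : Set (USpace × S) :=
    {p | (p.2 : FiniteMeasure Torus) ∈ dualSublevel c₀ C K ∧ IsShiftedSecondDeriv c₀ p.1 p.2}
  have hZ : IsClosed Z :=
    ((isClosed_dualSublevel c₀ C K).preimage (continuous_subtype_val.comp continuous_snd)).inter
      ((isClosed_isShiftedSecondDeriv c₀).preimage
        (continuous_fst.prodMk (continuous_subtype_val.comp continuous_snd)))
  have himage : {u | u ∈ energyDomain c₀ C ∧ energyReal c₀ u ≤ K} = Prod.fst '' Z := by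
    ext u
    rw [mem_ofPred_eq, mem_sublevel_iff hK]
    constructor
    · rintro ⟨μ, hμ, hu⟩
      exact ⟨(u, ⟨μ, NNReal.eq hu.mass_eq⟩), ⟨hμ, hu⟩, rfl⟩
    · rintro ⟨⟨v, μ⟩, hμ, rfl⟩
      exact ⟨μ, hμ⟩
  rw [himage]
  exact isClosedMap_fst_of_compactSpace _ hZ

theorem convexOn_energyReal (c₀ C : ℝ) : ConvexOn ℝ (energyDomain c₀ C) (energyReal c₀) := by
  have hcomb ⦃u⦄ (hu : u ∈ energyDomain c₀ C) ⦃v⦄ (hv : v ∈ energyDomain c₀ C) ⦃a b : ℝ⦄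
      (ha : 0 ≤ a) (hb : 0 ≤ b) (hab : a + b = 1) : a • u + b • v ∈ energyDomain c₀ C ∧
        energyReal c₀ (a • u + b • v) ≤ a * energyReal c₀ u + b * energyReal c₀ v := by
    obtain ⟨μ, hμ, huμ⟩ := exists_mem_dualSublevel hu
    obtain ⟨ν, hν, hvν⟩ := exists_mem_dualSublevel hv
    rw [mem_sublevel_iff (add_nonneg (mul_nonneg ha (energyReal_nonneg c₀ u))
      (mul_nonneg hb (energyReal_nonneg c₀ v)))]
    lift a to ℝ≥0 using ha
    lift b to ℝ≥0 using hb
    exact ⟨a • μ + b • ν, smul_add_smul_mem_dualSublevel hμ hν hab, huμ.smul_add_smul hvν hab⟩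
  exact ⟨fun u hu v hv a b ha hb hab => (hcomb hu hv ha hb hab).1,
    fun u hu v hv a b ha hb hab => (hcomb hu hv ha hb hab).2⟩

theorem zero_mem_energyDomain (hc₀ : 0 < c₀) (hC : 0 ≤ C) :
    (0 : USpace) ∈ energyDomain c₀ C := by
  have hhh : hh 0 = 0 := by
    have h := (hh_spec VTilde.zero_mem).smul 0
    rw [zero_smul, zero_smul, ← Submodule.coe_zero (p := USpace)] at h
    exact hh_eq h
  have hnorm : normV 0 ≤ C := by
    rw [normV, hhh, SignedMeasure.totalVariation_zero]
    exact hC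
  have hphi : phiDensity c₀ 0 ≠ ⊤ := by
    have hPhi : (fun x => Phi (acDensity 0 x + c₀)) =ᵐ[volume] fun _ => Phi c₀ := by
      have hrn : acDensity 0 =ᵐ[volume] 0 := by
        rw [acDensity, hhh]
        refine (SignedMeasure.eq_rnDeriv 0 0 (integrable_zero _ _ _)
          (VectorMeasure.MutuallySingular.zero_left) ?_).symm
        rw [withDensityᵥ_zero, add_zero]
      filter_upwards [hrn] with x hx
      rw [hx, Pi.zero_apply, zero_add]
    rw [phiDensity, lintegral_congr_ae hPhi, lintegral_const, UnitAddCircle.measure_univ, mul_one,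
      Phi, if_neg (not_le.2 hc₀)]
    exact ENNReal.ofReal_ne_top
  have hpos : PosMeasure c₀ 0 := by
    lift c₀ to ℝ≥0 using hc₀.le
    rw [PosMeasure, hhh, zero_add]
    refine (Measure.zero_le_toSignedMeasure (c₀ • (volume : Measure Torus))).trans_eq ?_
    exact Measure.toSignedMeasure_smul _ c₀
  exact ⟨VTilde.zero_mem, hpos, hnorm, hphi⟩

theorem mem_B_iff (hc₀ : 0 < c₀) (hC : 0 ≤ C) {w u : USpace} :
    u ∈ B c₀ C w ↔ IsSubgradient (energyDomain c₀ C) (energyReal c₀) w u := by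
  constructor
  · rintro ⟨hw, -, hsub⟩
    have hwD : w ∈ energyDomain c₀ C := by
      by_contra hne
      have hle := hsub 0
      rw [energy_eq_top (w := ⟨w, hw⟩) hne,
        energy_eq_coe (w := 0) (zero_mem_energyDomain hc₀ hC), EReal.top_add_coe,
        top_le_iff] at hle
      exact EReal.coe_ne_top _ hle
    refine ⟨hwD, fun y hy => ?_⟩
    have hle := hsub ⟨y, hy.1⟩
    rw [energy_eq_coe (w := ⟨w, hw⟩) hwD, energy_eq_coe (w := ⟨y, hy.1⟩) hy] at hle
    exact_mod_cast hle
  · rintro ⟨hw, hsub⟩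
    refine ⟨hw.1, ⟨4 * ‖u‖, fun v => ?_⟩, fun y => ?_⟩
    · calc |inner ℝ u (v : USpace)| ≤ ‖u‖ * ‖(v : USpace)‖ := abs_real_inner_le_norm _ _
        _ ≤ ‖u‖ * (4 * normV v) := by gcongr; exact norm_le_four_mul_normV v.2
        _ = 4 * ‖u‖ * normV v := by ring
    · by_cases hy : (y : USpace) ∈ energyDomain c₀ C
      · rw [energy_eq_coe (w := ⟨w, hw.1⟩) hw, energy_eq_coe hy]
        exact_mod_cast hsub y hy
      · rw [energy_eq_top hy]
        exact le_top

end Energy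

end ThinFilm

namespace ThinFilm

open Filter Topology MeasureDuality ConvexFlow CurveCalculus
open scoped NNReal

section PositivityOfDensity

variable {c₀ C : ℝ} {X : Type*} [TopologicalSpace X] {w : X → USpace} {μ : X → FiniteMeasure Torus}

theorem continuous_of_isShiftedSecondDeriv (hw : Continuous w)
    (hμ : ∀ t, IsShiftedSecondDeriv c₀ (w t) (μ t)) : Continuous μ := by
  have hmass (t : X) : (μ t).mass ≤ c₀.toNNReal := by
    rw [← (hμ t).mass_eq, Real.toNNReal_coe]
  refine continuous_finiteMeasure_of_dense dense_smoothFunctions hmass fun f hf => ?_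
  have htest (t : X) : ∫ x, f x ∂(μ t : Measure Torus) =
      (∫ x, (w t : L2Torus) x * dh (dh f) x) + c₀ * ∫ x, f x := by
    rw [hμ t f hf, sub_add_cancel]
  simp only [htest]
  exact ((continuous_integral_mul_smooth (SmoothOnTorus.dh hf).dh).comp hw).add continuous_const

theorem exists_measurable_acDensity [MeasurableSpace X] [OpensMeasurableSpace X]
    (hw : Continuous w) (hμ : ∀ t, IsShiftedSecondDeriv c₀ (w t) (μ t)) :
    ∃ η : X → Torus → ℝ, Measurable (Function.uncurry η) ∧
      ∀ t, η t =ᵐ[volume] acDensity (w t) := by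
  let κ : ProbabilityTheory.Kernel X Torus := ⟨fun t => (μ t : Measure Torus),
    measurable_toMeasure_of_continuous (continuous_of_isShiftedSecondDeriv hw hμ)⟩
  have hκ : ProbabilityTheory.IsFiniteKernel κ := by
    refine ⟨ENNReal.ofReal c₀, ENNReal.ofReal_lt_top, fun t => ?_⟩
    rw [← (hμ t).mass_eq, ENNReal.ofReal_coe_nnreal, FiniteMeasure.ennreal_mass]
    rfl
  let lebesgue : ProbabilityTheory.Kernel X Torus := ProbabilityTheory.Kernel.const X volume
  refine ⟨fun t x => (κ.rnDeriv lebesgue t x).toReal - c₀,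
    (ProbabilityTheory.Kernel.measurable_rnDeriv κ lebesgue).ennreal_toReal.sub_const c₀,
    fun t => ?_⟩
  have hslice : κ.rnDeriv lebesgue t =ᵐ[volume] (μ t : Measure Torus).rnDeriv volume :=
    ProbabilityTheory.Kernel.rnDeriv_eq_rnDeriv_measure (κ := κ) (η := lebesgue) (a := t)
  filter_upwards [hslice, (hμ t).acDensity_add_ae_eq] with x hx hac
  rw [hx, ← hac, add_sub_cancel_right]

theorem ae_pos_acDensity_add {u : USpace} (hu : phiDensity c₀ u ≠ ⊤) :
    ∀ᵐ x, 0 < acDensity u x + c₀ := by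
  have hmeas : Measurable fun x => Phi (acDensity u x + c₀) :=
    measurable_Phi.comp ((SignedMeasure.measurable_rnDeriv _ _).add_const c₀)
  filter_upwards [ae_lt_top hmeas hu] with x hx
  by_contra hneg
  rw [Phi, if_pos (not_lt.1 hneg)] at hx
  exact lt_irrefl _ hx

theorem isPositive_of_mem_energyDomain (T : ℝ) {w : ℝ → USpace} (hw : Continuous w)
    (hD : ∀ t, w t ∈ energyDomain c₀ C) : IsPositive c₀ T w := by
  choose μ hμ using fun t => exists_isShiftedSecondDeriv (hD t).1 (hD t).2.1
  obtain ⟨η, hη, hac⟩ := exists_measurable_acDensity hw hμ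
  refine ⟨Eventually.of_forall fun t => (hD t).1, Eventually.of_forall fun t => (hD t).2.1,
    η, hη.aestronglyMeasurable, Eventually.of_forall hac, ?_⟩
  have hset : MeasurableSet {p : ℝ × Torus | 0 < η p.1 p.2 + c₀} :=
    measurableSet_lt measurable_const (hη.add_const c₀)
  rw [Measure.ae_prod_iff_ae_ae hset]
  refine Eventually.of_forall fun t => ?_
  filter_upwards [ae_pos_acDensity_add (hD t).2.2.2, hac t] with x hpos hx
  rwa [hx]

theorem memLInfV_of_mem_energyDomain (T : ℝ) {w : ℝ → USpace} (hw : Continuous w)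
    (hD : ∀ t, w t ∈ energyDomain c₀ C) : MemLInfV T w := by
  choose μ hμ using fun t => exists_isShiftedSecondDeriv (hD t).1 (hD t).2.1
  refine ⟨Eventually.of_forall fun t => (hD t).1, ⟨C, Eventually.of_forall fun t => (hD t).2.2.1⟩,
    fun f => ?_⟩
  simp only [(hμ _).integral_hh f.continuous]
  exact (((continuous_integral_finiteMeasure f.continuous).comp
    (continuous_of_isShiftedSecondDeriv hw hμ)).sub continuous_const).aemeasurable

end PositivityOfDensity

section MemW1Inf

variable {T : ℝ} {w w' : ℝ → USpace}

namespace MemW1Inf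

theorem intervalIntegrable_deriv (h : MemW1Inf T w w') (hT : 0 ≤ T) :
    IntervalIntegrable w' volume 0 T :=
  (intervalIntegrable_iff_integrableOn_Icc_of_le hT).2 (h.memLp_deriv.integrable le_top)

theorem eq_add_integral (h : MemW1Inf T w w') (hT : 0 < T) :
    EqOn w (fun t => w 0 + ∫ s in 0..t, w' s) (Icc 0 T) :=
  eq_add_integral_of_weakDeriv hT h.continuousOn (h.intervalIntegrable_deriv hT.le) h.weak_deriv

theorem absolutelyContinuousOnInterval (h : MemW1Inf T w w') (hT : 0 < T) :
    AbsolutelyContinuousOnInterval w 0 T := by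
  refine absolutelyContinuousOnInterval_of_dist_le
    (absolutelyContinuousOnInterval_integral (h.intervalIntegrable_deriv hT.le))
    fun x hx y hy => ?_
  rw [uIcc_of_le hT.le] at hx hy
  rw [h.eq_add_integral hT hx, h.eq_add_integral hT hy, dist_add_left]

theorem ae_hasDerivAt (h : MemW1Inf T w w') (hT : 0 < T) :
    ∀ᵐ t, t ∈ Icc 0 T → HasDerivAt w (w' t) t := by
  filter_upwards [(h.intervalIntegrable_deriv hT.le).ae_hasDerivAt_integral,
    Ioo_ae_eq_Icc (μ := volume) (a := 0) (b := T)] with t hderiv hIoo htT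
  have ht : t ∈ Ioo 0 T := hIoo.mpr htT
  refine ((hderiv (Icc_subset_uIcc htT) 0 left_mem_uIcc).const_add (w 0)).congr_of_eventuallyEq ?_
  exact (h.eq_add_integral hT).eventuallyEq_of_mem (Icc_mem_nhds ht.1 ht.2)

end MemW1Inf

theorem memW1Inf_of_lipschitzWith [SecondCountableTopology USpace] {K : ℝ≥0}
    (hw : LipschitzWith K w) (hT : 0 ≤ T) : MemW1Inf T w (deriv w) := by
  have hbound (t : ℝ) : ‖deriv w t‖ ≤ K := norm_deriv_le_of_lipschitz hw
  have hmeas : AEStronglyMeasurable (deriv w) (volume.restrict (Icc 0 T)) :=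
    (stronglyMeasurable_deriv w).aestronglyMeasurable
  have hLinf : MemLp (deriv w) ⊤ (volume.restrict (Icc 0 T)) :=
    memLp_top_of_bound hmeas K (Eventually.of_forall hbound)
  have hac : AbsolutelyContinuousOnInterval w 0 T :=
    hw.lipschitzOnWith.absolutelyContinuousOnInterval
  have hint : IntervalIntegrable (deriv w) volume 0 T :=
    (intervalIntegrable_iff_integrableOn_Icc_of_le hT).2 (hLinf.integrable le_top)
  refine ⟨hw.continuous.continuousOn, ?_, hLinf, fun θ hθ _ hsupp => ?_⟩
  · obtain ⟨A, hA⟩ := isCompact_Icc.exists_bound_of_continuousOn hw.continuous.continuousOn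
    exact memLp_top_of_bound hw.continuous.aestronglyMeasurable A
      ((ae_restrict_iff' measurableSet_Icc).2 (Eventually.of_forall hA))
  · have hvanish {t : ℝ} (ht : t ∉ Ioo 0 T) : θ t = 0 :=
      image_eq_zero_of_notMem_tsupport fun hmem => ht (hsupp hmem)
    rw [integral_Icc_eq_integral_Ioc, integral_Icc_eq_integral_Ioc,
      ← intervalIntegral.integral_of_le hT, ← intervalIntegral.integral_of_le hT]
    exact integral_deriv_smul_eq_neg hac
      ((ae_differentiableAt_of_lipschitzWith hw).mono fun t ht _ => ht.hasDerivAt) hint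
      (hθ.of_le (by simp)) (hvanish left_notMem_Ioo) (hvanish right_notMem_Ioo)

end MemW1Inf

section CauchyProblem

variable {c₀ C T : ℝ} {w₀ : USpace} {w w' : ℝ → USpace}

theorem secondCountableTopology_USpace : SecondCountableTopology USpace := by
  have : Fact ((2 : ℝ≥0∞) ≠ ⊤) := ⟨ENNReal.ofNat_ne_top⟩
  have : SecondCountableTopology L2Torus := inferInstance
  exact TopologicalSpace.Subtype.secondCountableTopology (USpace : Set L2Torus)

theorem IsCauchySolution.eqOn (hc₀ : 0 < c₀) (hC : 0 ≤ C) (hT : 0 < T) {v v' : ℝ → USpace}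
    (hv : IsCauchySolution c₀ C T w₀ v v') (hw : IsCauchySolution c₀ C T w₀ w w') :
    EqOn v w (Icc 0 T) := by
  have hac : AbsolutelyContinuousOnInterval (v - w) 0 T :=
    (hv.memW1Inf.absolutelyContinuousOnInterval hT).sub
      (hw.memW1Inf.absolutelyContinuousOnInterval hT)
  have hderiv : ∀ᵐ t, t ∈ Icc 0 T → HasDerivAt (v - w) (v' t - w' t) t := by
    filter_upwards [hv.memW1Inf.ae_hasDerivAt hT, hw.memW1Inf.ae_hasDerivAt hT] with t htv htw ht
    exact (htv ht).sub (htw ht)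
  have hmonotone : ∀ᵐ t, t ∈ Icc 0 T → inner ℝ ((v - w) t) (v' t - w' t) ≤ 0 := by
    rw [← ae_restrict_iff' measurableSet_Icc]
    filter_upwards [hv.inclusion, hw.inclusion] with t htv htw
    have hnonneg := ((mem_B_iff hc₀ hC).1 htv).inner_sub_sub_nonneg ((mem_B_iff hc₀ hC).1 htw)
    rwa [neg_sub_neg, ← neg_sub, inner_neg_left, neg_nonneg, real_inner_comm] at hnonneg
  have hinitial : (v - w) 0 = 0 := sub_eq_zero.2 (hv.initial.trans hw.initial.symm)
  exact fun t ht => sub_eq_zero.1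
    (eqOn_zero_of_inner_deriv_nonpos hac hT.le hderiv hmonotone hinitial ht)

theorem ae_neg_deriv_mem_B [SecondCountableTopology USpace] (hc₀ : 0 < c₀) (hC : 0 ≤ C)
    {K : ℝ≥0} (hlip : LipschitzWith K w)
    (hw : IsEVISolution (energyDomain c₀ C) (energyReal c₀) w) :
    ∀ᵐ t ∂(volume.restrict (Icc 0 T)), -deriv w t ∈ B c₀ C (w t) := by
  rw [← restrict_Ioc_eq_restrict_Icc, ae_restrict_iff' measurableSet_Ioc]
  filter_upwards [ae_differentiableAt_of_lipschitzWith hlip] with t hdiff ht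
  exact (mem_B_iff hc₀ hC).2 (hw.isSubgradient_neg_deriv ht.1 hdiff.hasDerivAt)

theorem energy_le_of_neg_mem_B {u u' : USpace} (h : -u' ∈ B c₀ C u) :
    ∃ hu : u ∈ VTilde, ∀ v : VTilde,
      energy c₀ C ⟨u, hu⟩ ≤ ((inner ℝ u' ((v : USpace) - u) : ℝ) : EReal) + energy c₀ C v := by
  obtain ⟨hu, -, hsub⟩ := h
  refine ⟨hu, fun v => ?_⟩
  have hle : energy c₀ C ⟨u, hu⟩ + ((inner ℝ (-u') ((v : USpace) - u) : ℝ) : EReal) ≤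
      energy c₀ C v := hsub v
  rw [inner_neg_left, EReal.coe_neg, ← sub_eq_add_neg] at hle
  rw [add_comm]
  exact EReal.sub_le_iff_le_add (Or.inl (EReal.coe_ne_bot _)) (Or.inl (EReal.coe_ne_top _)) |>.1 hle

theorem IsCauchySolution.isVISolution (h : IsCauchySolution c₀ C T w₀ w w')
    (hw : MemLInfV T w) : IsVISolution c₀ C T w w' :=
  ⟨h.memW1Inf, hw, h.inclusion.mono fun _ => energy_le_of_neg_mem_B⟩

end CauchyProblem

end ThinFilm

theorem theorem2p3 (c₀ C T : ℝ) (hc₀ : 0 < c₀) (hC : 0 < C) (hT : 0 < T)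
    (w₀ : ThinFilm.USpace) (hw₀ : w₀ ∈ ThinFilm.domB c₀ C) :
    ∃ w w' : ℝ → ThinFilm.USpace,
      ThinFilm.IsCauchySolution c₀ C T w₀ w w' ∧
      (∀ v v' : ℝ → ThinFilm.USpace, ThinFilm.IsCauchySolution c₀ C T w₀ v v' →
        Set.EqOn v w (Set.Icc 0 T)) ∧
      ThinFilm.IsVISolution c₀ C T w w' ∧
      ThinFilm.IsPositive c₀ T w := by
  obtain ⟨ξ₀, hξ₀⟩ := hw₀
  have := ThinFilm.secondCountableTopology_USpace
  obtain ⟨w, hinitial, hlip, hD, hevi⟩ :=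
    ((ThinFilm.mem_B_iff hc₀ hC.le).1 hξ₀).exists_isEVISolution
      (ThinFilm.convexOn_energyReal c₀ C) (ThinFilm.isClosed_sublevel hc₀.le C)
  have hsol : ThinFilm.IsCauchySolution c₀ C T w₀ w (deriv w) :=
    ⟨ThinFilm.memW1Inf_of_lipschitzWith hlip hT.le,
      ThinFilm.ae_neg_deriv_mem_B hc₀ hC.le hlip hevi, hinitial⟩
  exact ⟨w, deriv w, hsol, fun v v' hv => hv.eqOn hc₀ hC.le hT hsol,
    hsol.isVISolution (ThinFilm.memLInfV_of_mem_energyDomain T hlip.continuous hD),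
    ThinFilm.isPositive_of_mem_energyDomain T hlip.continuous hD⟩
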